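/- Let $L$ be an even non-degenerate integral lattice with bilinear form $(\cdot,\cdot)$, signature $(b^+,b^-)$, $\dim(L)=b^++b^-$ and $\mathrm{sgn}(L)=b^+-b^-$; let $L'\subset L\otimes\mathbb{Q}$ be its dual and $A=L'/L$ its discriminant group, with $q(x+L)=\tfrac12(x,x) \bmod \mathbb{Z}$. For an integer $r\ge 1$ let $L(r)$ be the lattice $L$ with the form $r(\cdot,\cdot)$, and let $A(r)=L(r)'/L\supseteq A$ be its discriminant group, with quadratic form $q_r(x+L)=\tfrac r2(x,x)\bmod\mathbb{Z}$. Write $\boldsymbol{e}(x)=\exp(2\pi i x)$ and let $(e_\lambda)_{\lambda\in A}$ be the standard basis of $\mathbb{C}[A]$. Let $\widetilde{\mathrm{GL}}{}_2^+(\mathbb{Q})$ be the group of pairs $(M,\phi)$ with $M=\begin{pmatrix}a&b\\c&d\end{pmatrix}\in \mathrm{GL}_2^+(\mathbb{Q})$ and $\phi$ a holomorphic function on the upper half-plane with $\phi(\tau)^2=c\tau+d$, with product $(M_1,\phi_1)(M_2,\phi_2)=(M_1M_2,\phi_1(M_2\tau)\phi_2(\tau))$, and let $\mathrm{Mp}_2(\mathbb{Z})$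 be the subgroup of the pairs with $M\in\mathrm{SL}_2(\mathbb{Z})$. Let $\rho_L$ be the Weil representation of $\mathrm{Mp}_2(\mathbb{Z})$ on $\mathbb{C}[A]$, that is, the representation with $$\rho_L(T)e_\lambda=\boldsymbol{e}(q(\lambda))\,e_\lambda,\qquad \rho_L(S)e_\lambda=\frac{\boldsymbol{e}(-\mathrm{sgn}(L)/8)}{\sqrt{|A|}}\sum_{\mu\in A}\boldsymbol{e}(-(\lambda,\mu))\,e_\mu,$$ where $T=\left(\begin{pmatrix}1&1\\0&1\end{pmatrix},1\right)$ and $S=\left(\begin{pmatrix}0&-1\\1&0\end{pmatrix},\sqrt\tau\right)$ (principal branch). Let $p$ be an odd prime, let $a,l$ be positive integers with $a<2l$, and let $b$ be an integer that is a unit modulo $p^a$. Put $$\alpha=\left(\begin{pmatrix}p^{2l}&0\\0&1\end{pmatrix},1\right),\qquad \beta_{b,a}=\left(\begin{pmatrix}p^{2l-a}&b\\0&p^a\end{pmatrix},\sqrt{p^a}\right).$$ The Bruinier--Stein extension of $\rho_L$ to the double coset $\mathrm{Mp}_2(\mathbb{Z})\,\alpha\,\mathrm{Mp}_2(\mathbb{Z})$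 is given by $\rho_L^{-1}(\alpha)e_\lambda=e_{p^l\lambda}$ and $\rho_L^{-1}(\gamma\alpha\gamma')=\rho_L^{-1}(\gamma')\,\rho_L^{-1}(\alpha)\,\rho_L^{-1}(\gamma)$ for $\gamma,\gamma'\in\mathrm{Mp}_2(\mathbb{Z})$. Then the representation $\rho_L$ exists, the element $\beta_{b,a}$ lies in this double coset, the operator $\rho_L^{-1}(\beta_{b,a})$ does not depend on the way of writing $\beta_{b,a}=\gamma\alpha\gamma'$, and for all $\lambda\in A$ $$\rho_L^{-1}(\beta_{b,a})e_\lambda=\begin{cases}\displaystyle p^{-\frac a2\dim(L)}\sum_{\substack{\delta\in A(p^a)\\ p^a\delta=\lambda}}\boldsymbol{e}\bigl(-b\,q_{p^a}(\delta)\bigr)\,e_{p^{l-a}\lambda}&\text{if } l\ge a,\\[3ex] \displaystyle p^{-\frac a2\dim(L)}\sum_{\substack{\mu\in A\\ p^{a-l}\mu=\lambda}}\ \sum_{\substack{\delta\in A(p^l)\\ p^l\delta=\mu}}\boldsymbol{e}\bigl(-b\,p^{a-l}q_{p^l}(\delta)\bigr)\,e_\mu&\text{if } l<a.\end{cases}$$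 -/

import Mathlib

open UpperHalfPlane Matrix
open scoped Manifold MatrixGroups

noncomputable section

/-! ## The metaplectic groups -/

/-- The real matrix underlying an element of `GL₂⁺(ℚ)`; it acts on `ℍ` by Möbius
transformations. -/
def toGLReal : GL(2, ℚ)⁺ →* GL (Fin 2) ℝ :=
  (Matrix.GeneralLinearGroup.map (algebraMap ℚ ℝ)).comp (Matrix.GLPos (Fin 2) ℚ).subtype

lemma toGLReal_det_pos (M : GL(2, ℚ)⁺) : 0 < (toGLReal M).det.val := by
  have h : (0 : ℚ) < (M : GL (Fin 2) ℚ).det.val := M.2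
  have h2 : (toGLReal M).det.val = (((M : GL (Fin 2) ℚ).det.val : ℚ) : ℝ) := by
    simp [toGLReal, Matrix.det_fin_two]
  rw [h2]
  exact_mod_cast h

/-- The metaplectic twofold cover of `GL₂⁺(ℚ)`: pairs `(M, φ)` with `M = (a b; c d)` in `GL₂⁺(ℚ)`
and `φ` a holomorphic function on `ℍ` such that `φ(τ)² = c τ + d`. -/
@[ext]
structure MpGL where
  /-- the underlying matrix -/
  mat : GL(2, ℚ)⁺
  /-- the chosen holomorphic square root of `c τ + d` -/
  phi : ℍ → ℂ
  holo : MDifferentiable 𝓘(ℂ) 𝓘(ℂ) phi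
  sq : ∀ τ : ℍ, phi τ ^ 2 = denom (toGLReal mat) τ

namespace MpGL

lemma phi_ne_zero (g : MpGL) (τ : ℍ) : g.phi τ ≠ 0 := by
  intro h
  have := g.sq τ
  rw [h] at this
  exact denom_ne_zero (toGLReal g.mat) τ (by rw [← this]; simp)

lemma denom_mul (M N : GL(2, ℚ)⁺) (τ : ℍ) :
    denom (toGLReal (M * N)) τ
      = denom (toGLReal M) (toGLReal N • τ : ℍ) * denom (toGLReal N) τ := by
  rw [map_mul, denom_cocycle_σ, σ, if_pos (toGLReal_det_pos N)]
  rfl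

/-- `(M₁, φ₁) (M₂, φ₂) = (M₁ M₂, φ₁(M₂ τ) φ₂(τ))`. -/
instance : Mul MpGL where
  mul g h :=
    { mat := g.mat * h.mat
      phi := fun τ => g.phi (toGLReal h.mat • τ) * h.phi τ
      holo := (g.holo.comp (mdifferentiable_smul (toGLReal_det_pos h.mat))).mul h.holo
      sq := fun τ => by rw [mul_pow, g.sq, h.sq, denom_mul] }

instance : One MpGL where
  one :=
    { mat := 1
      phi := fun _ => 1
      holo := mdifferentiable_const
      sq := fun τ => by simp [denom] }

instance : Inv MpGL where
  inv g :=
    { mat := g.mat⁻¹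
      phi := fun τ => (g.phi (toGLReal g.mat⁻¹ • τ))⁻¹
      holo := by
        have h := g.holo.comp (mdifferentiable_smul (toGLReal_det_pos g.mat⁻¹))
        rw [UpperHalfPlane.mdifferentiable_iff] at h ⊢
        exact h.inv (fun z _ => g.phi_ne_zero _)
      sq := fun τ => by
        rw [inv_pow, g.sq]
        have h := denom_mul g.mat g.mat⁻¹ τ
        rw [mul_inv_cancel, map_one] at h
        have h1 : denom (1 : GL (Fin 2) ℝ) (τ : ℂ) = 1 := by simp [denom]
        rw [h1] at h
        exact (eq_inv_of_mul_eq_one_right h.symm).symm }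

@[simp] lemma mul_mat (g h : MpGL) : (g * h).mat = g.mat * h.mat := rfl
@[simp] lemma mul_phi (g h : MpGL) (τ : ℍ) :
    (g * h).phi τ = g.phi (toGLReal h.mat • τ) * h.phi τ := rfl
@[simp] lemma one_mat : (1 : MpGL).mat = 1 := rfl
@[simp] lemma one_phi (τ : ℍ) : (1 : MpGL).phi τ = 1 := rfl
@[simp] lemma inv_mat (g : MpGL) : (g⁻¹).mat = g.mat⁻¹ := rfl
@[simp] lemma inv_phi (g : MpGL) (τ : ℍ) :
    (g⁻¹).phi τ = (g.phi (toGLReal g.mat⁻¹ • τ))⁻¹ := rfl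

instance : Group MpGL where
  mul_assoc f g h := by
    ext1
    · simp [mul_assoc]
    · funext τ
      simp [mul_assoc, mul_smul]
  one_mul g := by
    ext1
    · simp
    · funext τ; simp
  mul_one g := by
    ext1
    · simp
    · funext τ; simp
  inv_mul_cancel g := by
    ext1
    · simp
    · funext τ
      have h : toGLReal g.mat⁻¹ • toGLReal g.mat • τ = τ := by
        rw [← mul_smul, ← map_mul]; simp
      simp only [mul_phi, inv_phi, one_phi, h]
      exact inv_mul_cancel₀ (g.phi_ne_zero τ)

/-- The element `((x y; 0 z), c)`, with the constant function `c`, where `c² = z`. -/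
def triangular (x y z : ℚ) (c : ℝ) (hxz : 0 < x * z) (hc : c ^ 2 = z) : MpGL where
  mat := ⟨Matrix.GeneralLinearGroup.mkOfDetNeZero !![x, y; 0, z]
      (by simp only [Matrix.det_fin_two_of]; simpa using hxz.ne'), by
    rw [Matrix.mem_glpos]
    simpa [Matrix.GeneralLinearGroup.mkOfDetNeZero] using hxz⟩
  phi := fun _ => (c : ℂ)
  holo := mdifferentiable_const
  sq := fun τ => by
    have : (c : ℂ) ^ 2 = ((z : ℝ) : ℂ) := by rw [← hc]; push_cast; rfl
    simp [denom, toGLReal, Matrix.GeneralLinearGroup.mkOfDetNeZero, this]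

end MpGL

/-- `Mp₂(ℤ)`: the pairs `(M, φ)` with `M ∈ SL₂(ℤ)`. -/
def Mp2Z : Subgroup MpGL where
  carrier := {g | ∃ M : SL(2, ℤ),
    g.mat = Matrix.SpecialLinearGroup.toGLPos (M.map (Int.castRingHom ℚ))}
  mul_mem' := by
    rintro g h ⟨M, hM⟩ ⟨N, hN⟩
    exact ⟨M * N, by simp [hM, hN]⟩
  one_mem' := ⟨1, by simp⟩
  inv_mem' := by
    rintro g ⟨M, hM⟩
    exact ⟨M⁻¹, by rw [MpGL.inv_mat, hM, ← map_inv, ← map_inv]⟩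

/-- `T = ((1 1; 0 1), 1)`. -/
def mpT : Mp2Z :=
  ⟨MpGL.triangular 1 1 1 1 (by norm_num) (by norm_num), ⟨ModularGroup.T, by
    apply Subtype.ext
    ext i j
    rw [Matrix.SpecialLinearGroup.coe_GLPos_coe_GL_coe_matrix,
      Matrix.SpecialLinearGroup.map_apply_coe, ModularGroup.coe_T]
    fin_cases i <;> fin_cases j <;>
      simp [MpGL.triangular, Matrix.GeneralLinearGroup.mkOfDetNeZero]⟩⟩

/-- `S = ((0 -1; 1 0), √τ)`, with the principal branch of the square root. -/
def mpS : Mp2Z :=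
  ⟨{ mat := Matrix.SpecialLinearGroup.toGLPos (ModularGroup.S.map (Int.castRingHom ℚ))
     phi := fun τ => (τ : ℂ) ^ (1 / 2 : ℂ)
     holo := by
      rw [UpperHalfPlane.mdifferentiable_iff]
      have h : DifferentiableOn ℂ (fun z : ℂ => z ^ (1 / 2 : ℂ)) {z | 0 < z.im} := by
        intro z hz
        exact ((differentiableAt_id.cpow (differentiableAt_const _)
          (Or.inr (ne_of_gt hz))).differentiableWithinAt)
      refine h.congr (fun z hz => ?_)
      simp [Function.comp, ofComplex_apply_of_im_pos hz]
     sq := fun τ => by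
      rw [← Complex.cpow_nat_mul]
      have h : ((ModularGroup.S.map (Int.castRingHom ℚ) : SL(2, ℚ)) : Matrix (Fin 2) (Fin 2) ℚ)
          = !![0, -1; 1, 0] := by
        rw [Matrix.SpecialLinearGroup.map_apply_coe, ModularGroup.coe_S]
        ext i j
        fin_cases i <;> fin_cases j <;> simp
      simp [denom, toGLReal, h] }, ⟨ModularGroup.S, rfl⟩⟩

/-! ## Even lattices and their discriminant forms -/

/-- `𝐞(x) = exp(2πix)`, as a function of `x ∈ ℚ/ℤ`. -/
def expQZ : AddCircle (1 : ℚ) → ℂ :=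
  Function.Periodic.lift (f := fun x : ℚ => Complex.exp (2 * Real.pi * Complex.I * (x : ℂ)))
    (c := 1) (fun x => by
      push_cast
      rw [mul_add, mul_one, Complex.exp_add, Complex.exp_two_pi_mul_I, mul_one])

/-- An even non-degenerate integral lattice `L`, realized inside the rational quadratic space
`V = L ⊗ ℚ`. The form takes integral values on `L × L` by polarization. -/
structure EvenLattice (V : Type*) [AddCommGroup V] [Module ℚ V] where
  /-- the bilinear form `(x, y)` on `V = L ⊗ ℚ` -/
  form : LinearMap.BilinForm ℚ V
  symm : form.IsSymm
  nondeg : form.Nondegenerate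
  /-- the lattice `L ⊆ V` -/
  carrier : Submodule ℤ V
  /-- `L` is finitely generated and spans `V` over `ℚ` -/
  lattice : Submodule.IsLattice ℚ carrier
  even : ∀ x ∈ carrier, ∃ k : ℤ, form x x = 2 * k

namespace EvenLattice

variable {V : Type*} [AddCommGroup V] [Module ℚ V]

/-- `dim(L) = b⁺ + b⁻`, the rank of `L`. -/
def dim (L : EvenLattice V) : ℕ := Module.finrank ℤ L.carrier

/-- `sgn(L) = b⁺ - b⁻`. -/
def sgn (L : EvenLattice V) : ℤ :=
  (sigPos L.form.toQuadraticMap : ℤ) - (sigNeg L.form.toQuadraticMap : ℤ)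

/-- The lattice `L(r)`: the same group `L` with the form `(x, y)_r = r (x, y)`. -/
def rescale (L : EvenLattice V) (r : ℕ) [NeZero r] : EvenLattice V where
  form := (r : ℚ) • L.form
  symm := ⟨fun x y => by simp [L.symm.eq x y]⟩
  nondeg := by
    have hr : (r : ℚ) ≠ 0 := Nat.cast_ne_zero.mpr (NeZero.ne r)
    refine ⟨fun x hx => L.nondeg.1 x fun y => ?_, fun x hx => L.nondeg.2 x fun y => ?_⟩
    · simpa [hr] using hx y
    · simpa [hr] using hx y
  carrier := L.carrier
  lattice := L.lattice
  even := fun x hx => by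
    obtain ⟨k, hk⟩ := L.even x hx
    exact ⟨r * k, by simp [hk]; ring⟩

/-- The dual lattice `L' = {x ∈ L ⊗ ℚ | (x, y) ∈ ℤ for all y ∈ L}`. -/
def dual (L : EvenLattice V) : Submodule ℤ V := L.form.dualSubmodule L.carrier

lemma mem_dual {L : EvenLattice V} {x : V} :
    x ∈ L.dual ↔ ∀ y ∈ L.carrier, ∃ k : ℤ, (k : ℚ) = L.form x y := by
  simp [dual, LinearMap.BilinForm.mem_dualSubmodule, Submodule.mem_one]

/-- The discriminant group `A = L'/L`. The group `A(r)` is `(L.rescale r).Disc`. -/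
abbrev Disc (L : EvenLattice V) : Type _ := L.dual ⧸ L.carrier.submoduleOf L.dual

lemma coe_half_eq (L : EvenLattice V) (x y : L.dual)
    (h : -x + y ∈ (L.carrier.submoduleOf L.dual).toAddSubgroup) :
    ((L.form x x / 2 : ℚ) : AddCircle (1 : ℚ)) = ((L.form y y / 2 : ℚ) : AddCircle (1 : ℚ)) := by
  have hz : (-x + y : V) ∈ L.carrier := h
  obtain ⟨k, hk⟩ := L.even _ hz
  obtain ⟨m, hm⟩ := mem_dual.1 x.2 _ hz
  have hs := L.symm.eq (x : V) (y : V)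
  rw [← sub_eq_zero, ← AddCircle.coe_sub, AddCircle.coe_eq_zero_iff]
  refine ⟨-(k + m), ?_⟩
  simp only [map_add, map_neg, LinearMap.add_apply, LinearMap.neg_apply] at hk hm
  simp only [zsmul_eq_mul, Int.cast_neg, Int.cast_add, mul_one]
  linarith

/-- The discriminant quadratic form `q(x + L) = (x, x)/2 mod ℤ`. -/
def q (L : EvenLattice V) (γ : L.Disc) : AddCircle (1 : ℚ) :=
  Quotient.liftOn' γ (fun x => ((L.form x x / 2 : ℚ) : AddCircle (1 : ℚ)))
    (fun x y h => L.coe_half_eq x y (QuotientAddGroup.leftRel_apply.1 h))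

lemma coe_form_eq (L : EvenLattice V) (x y x' y' : L.dual)
    (hx : -x + x' ∈ (L.carrier.submoduleOf L.dual).toAddSubgroup)
    (hy : -y + y' ∈ (L.carrier.submoduleOf L.dual).toAddSubgroup) :
    ((L.form x y : ℚ) : AddCircle (1 : ℚ)) = ((L.form x' y' : ℚ) : AddCircle (1 : ℚ)) := by
  have hx' : (-x + x' : V) ∈ L.carrier := hx
  have hy' : (-y + y' : V) ∈ L.carrier := hy
  obtain ⟨k, hk⟩ := mem_dual.1 x.2 _ hy'
  obtain ⟨m, hm⟩ := mem_dual.1 y'.2 _ hx'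
  have hs := L.symm.eq (x : V) (y' : V)
  have hs' := L.symm.eq (x' : V) (y' : V)
  rw [← sub_eq_zero, ← AddCircle.coe_sub, AddCircle.coe_eq_zero_iff]
  refine ⟨-(k + m), ?_⟩
  simp only [map_add, map_neg] at hk hm
  simp only [zsmul_eq_mul, Int.cast_neg, Int.cast_add, mul_one]
  linarith

/-- The bilinear form `(x + L, y + L) = (x, y) mod ℤ` on the discriminant group. -/
def bil (L : EvenLattice V) (γ δ : L.Disc) : AddCircle (1 : ℚ) :=
  Quotient.liftOn₂' γ δ (fun x y => ((L.form x y : ℚ) : AddCircle (1 : ℚ)))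
    (fun x y x' y' hx hy => L.coe_form_eq x y x' y'
      (QuotientAddGroup.leftRel_apply.1 hx) (QuotientAddGroup.leftRel_apply.1 hy))

lemma dual_le_rescale (L : EvenLattice V) (r : ℕ) [NeZero r] : L.dual ≤ (L.rescale r).dual := by
  intro x hx
  rw [mem_dual] at hx ⊢
  intro y hy
  obtain ⟨k, hk⟩ := hx y hy
  exact ⟨r * k, by simp [rescale, hk]⟩

/-- The inclusion `A = L'/L ⊆ A(r) = L(r)'/L`, `x + L ↦ x + L`. -/
def incl (L : EvenLattice V) (r : ℕ) [NeZero r] : L.Disc →ₗ[ℤ] (L.rescale r).Disc :=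
  Submodule.mapQ _ _ (Submodule.inclusion (L.dual_le_rescale r)) (fun _ hx => hx)

/-- The discriminant group is finite. -/
instance finite_disc (L : EvenLattice V) : Finite L.Disc := by
  have := L.lattice
  have hfg : L.dual.FG := by
    let b₀ := Module.Free.chooseBasis ℤ L.carrier
    let b := b₀.extendOfIsLattice ℚ
    have hspan : L.carrier = Submodule.span ℤ (Set.range b) := by
      have h := congrArg (Submodule.map L.carrier.subtype) b₀.span_eq
      rw [Submodule.map_top, Submodule.range_subtype, Submodule.map_span] at h
      refine h.symm.trans ?_
      rw [← Set.range_comp]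
      congr 2
      funext i
      simp [b]
    classical
    rw [dual, hspan, LinearMap.BilinForm.dualSubmodule_span_of_basis _ L.nondeg b]
    exact Submodule.fg_span (Set.finite_range _)
  have : Module.Finite ℤ L.dual := Module.Finite.iff_fg.2 hfg
  have hmul : ∀ x : V, ∃ n : ℤ, n ≠ 0 ∧ n • x ∈ L.carrier := by
    intro x
    have hx : x ∈ Submodule.span ℚ (L.carrier : Set V) := by
      rw [Submodule.IsLattice.span_eq_top]; trivial
    induction hx using Submodule.span_induction with
    | mem x hx => exact ⟨1, one_ne_zero, by simpa using hx⟩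
    | zero => exact ⟨1, one_ne_zero, by simp⟩
    | add x y _ _ hx hy =>
      obtain ⟨n, hn, hnx⟩ := hx
      obtain ⟨m, hm, hmy⟩ := hy
      refine ⟨m * n, mul_ne_zero hm hn, ?_⟩
      rw [smul_add, mul_smul, mul_comm, mul_smul]
      exact add_mem (L.carrier.smul_mem _ hnx) (L.carrier.smul_mem _ hmy)
    | smul c x _ hx =>
      obtain ⟨n, hn, hnx⟩ := hx
      refine ⟨c.den * n, mul_ne_zero (by exact_mod_cast c.den_ne_zero) hn, ?_⟩
      have h : ((c.den * n : ℤ) • (c • x) : V) = c.num • (n • x) := by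
        rw [← Int.cast_smul_eq_zsmul ℚ, ← Int.cast_smul_eq_zsmul ℚ c.num,
          ← Int.cast_smul_eq_zsmul ℚ n, smul_smul, smul_smul]
        congr 1
        push_cast
        rw [mul_right_comm, mul_comm (c.den : ℚ) c, Rat.mul_den_eq_num]
      rw [h]
      exact L.carrier.smul_mem _ hnx
  refine Module.finite_of_fg_torsion L.Disc ?_
  intro γ
  obtain ⟨x, rfl⟩ := Submodule.Quotient.mk_surjective _ γ
  obtain ⟨n, hn, hx⟩ := hmul x
  refine ⟨⟨n, mem_nonZeroDivisors_of_ne_zero hn⟩, ?_⟩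
  change n • (Submodule.Quotient.mk x : L.Disc) = 0
  rw [← Submodule.Quotient.mk_smul, Submodule.Quotient.mk_eq_zero]
  exact hx

instance fintype_disc (L : EvenLattice V) : Fintype L.Disc := Fintype.ofFinite _

/-! ## The Weil representation and its extension -/

/-- The space `ℂ[A]`; its standard basis vector `e_γ` is `L.basisVec γ`. -/
abbrev GroupSpace (L : EvenLattice V) : Type _ := L.Disc →₀ ℂ

/-- The standard basis vector `e_γ` of `ℂ[A]`. -/
def basisVec (L : EvenLattice V) (γ : L.Disc) : L.GroupSpace := Finsupp.single γ 1

/-- The defining formulas of the Weil representation on the generators `T` and `S` of `Mp₂(ℤ)`. -/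
def IsWeilRep (L : EvenLattice V) (ρ : Representation ℂ Mp2Z L.GroupSpace) : Prop :=
  (∀ γ : L.Disc, ρ mpT (L.basisVec γ) = expQZ (L.q γ) • L.basisVec γ) ∧
  (∀ γ : L.Disc, ρ mpS (L.basisVec γ) =
    (expQZ ((-(L.sgn : ℚ) / 8 : ℚ) : AddCircle (1 : ℚ)) / (Real.sqrt (Nat.card L.Disc) : ℂ)) •
      ∑ μ : L.Disc, expQZ (-(L.bil γ μ)) • L.basisVec μ)

open Classical in
/-- The Weil representation `ρ_L` of `Mp₂(ℤ)` on `ℂ[A]`: the representation with the prescribed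
values at the generators `T` and `S`. (The `else` branch is a default value.) -/
def weilRep (L : EvenLattice V) : Representation ℂ Mp2Z L.GroupSpace :=
  if h : ∃ ρ, L.IsWeilRep ρ then h.choose else 1

/-- The operator `ρ_L⁻¹(α)`, `e_γ ↦ e_{m γ}`, for `α = ((m² 0; 0 1), 1)`. -/
def alphaOp (L : EvenLattice V) (m : ℕ) : L.GroupSpace →ₗ[ℂ] L.GroupSpace :=
  Finsupp.linearCombination ℂ (fun γ => L.basisVec (m • γ))

end EvenLattice

/-- `α = ((p^{2l} 0; 0 1), 1)`. -/
def mpAlpha (p l : ℕ) [NeZero p] : MpGL :=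
  MpGL.triangular ((p : ℚ) ^ (2 * l)) 0 1 1
    (by
      have : 0 < (p : ℚ) := by exact_mod_cast NeZero.pos p
      positivity)
    (by norm_num)

/-- `β_{b,a} = ((p^{2l-a} b; 0 p^a), √(p^a))`. -/
def mpBeta (p l : ℕ) [NeZero p] (b : ℤ) (a : ℕ) : MpGL :=
  MpGL.triangular ((p : ℚ) ^ (2 * l - a)) b ((p : ℚ) ^ a) (Real.sqrt ((p : ℝ) ^ a))
    (by
      have : 0 < (p : ℚ) := by exact_mod_cast NeZero.pos p
      positivity)
    (by
      rw [Real.sq_sqrt (by positivity)]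
      push_cast
      rfl)

namespace EvenLattice

variable {V : Type*} [AddCommGroup V] [Module ℚ V]

/-- The operator `ρ_L⁻¹(γ') ρ_L⁻¹(α) ρ_L⁻¹(γ)` attached to a product `γ α γ'` with
`γ, γ' ∈ Mp₂(ℤ)`. -/
def doubleCosetOp (L : EvenLattice V) (p l : ℕ) (γ γ' : Mp2Z) :
    L.GroupSpace →ₗ[ℂ] L.GroupSpace :=
  L.weilRep γ'⁻¹ ∘ₗ L.alphaOp (p ^ l) ∘ₗ L.weilRep γ⁻¹

open Classical in
/-- The extension `δ ↦ ρ_L⁻¹(δ)` of the Weil representation to the double coset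
`Mp₂(ℤ) α Mp₂(ℤ)`: for `δ = γ α γ'` it is `ρ_L⁻¹(γ') ρ_L⁻¹(α) ρ_L⁻¹(γ)`. (Outside the double
coset the value is a default.) -/
def extOp (L : EvenLattice V) (p l : ℕ) [NeZero p] (δ : MpGL) :
    L.GroupSpace →ₗ[ℂ] L.GroupSpace :=
  if h : ∃ g : Mp2Z × Mp2Z, δ = (g.1 : MpGL) * mpAlpha p l * (g.2 : MpGL) then
    L.doubleCosetOp p l h.choose.1 h.choose.2
  else 0

/-- The extension is well defined at `δ`: the element `δ` lies in the double coset
`Mp₂(ℤ) α Mp₂(ℤ)`, and for every way of writing `δ = γ α γ'` with `γ, γ' ∈ Mp₂(ℤ)` the operator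
`ρ_L⁻¹(δ)` equals `ρ_L⁻¹(γ') ρ_L⁻¹(α) ρ_L⁻¹(γ)`. -/
def ExtWellDefinedAt (L : EvenLattice V) (p l : ℕ) [NeZero p] (δ : MpGL) : Prop :=
  (∃ γ γ' : Mp2Z, δ = (γ : MpGL) * mpAlpha p l * (γ' : MpGL)) ∧
  ∀ γ γ' : Mp2Z, δ = (γ : MpGL) * mpAlpha p l * (γ' : MpGL) →
    L.extOp p l δ = L.doubleCosetOp p l γ γ'

end EvenLattice

end

noncomputable section

set_option linter.unusedSectionVars false

/-! ## Jacobi theta functions and the slash action -/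

/-! The operator is read off from theta functions, on which all of `MpGL` acts and not only `Mp2Z`.
In rank one take the series Σ f(r) 𝐞(τ r²/(2N) + r z), with f a function on ℤ/N and N even. The
weight 1/2 Jacobi slash by an element of Mp₂(ℤ) preserves their span, and the slash by an integral
triangular matrix of determinant uw carries it to level N·uw. Since f is determined by its series
(`thetaSeries_injective`), the matrix K(g) of the action is unique. The slash being a right action,
K(gh) = K(h)K(g), which is the reversed order of ρ⁻¹(γαγ') = ρ⁻¹(γ')ρ⁻¹(α)ρ⁻¹(γ).

For general L choose an orthogonal basis of vectors vᵢ ∈ L with (vᵢ,vᵢ) = εᵢNᵢ (`nonempty_frame`)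
and let M be its span, so that M'/M = ∏ ℤ/Nᵢ. Let W(g) be the tensor product of the matrices Kᵢ(g),
complex conjugated where εᵢ = 1, and let P : ℂ[M'/M] → ℂ[L'/L] be the natural map (`proj`). Because
L'/M is the orthogonal complement of L/M, a check on S and T gives W(g)Pᵀρ(g) = Pᵀ and ρ(g)PW(g) = P
on the group they generate, which is Mp₂(ℤ) (`weil_mul_transpose`, `proj_mul_weil`,
`closure_mpT_mpS`). Thus W induces ρ⁻¹ on ℂ[L'/L], and this also constructs ρ (`weilMatrix`).

Put m = p^l. An element of determinant m² carries ℂ[M'/M] to ℂ[(mM)'/mM], and mM is again an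
orthogonal sublattice of L. One has ρ⁻¹(α) = [L:M]⁻¹ P_{mM} W(α) P_Mᵀ (`toMat_alphaOp_eq`). Moving
ρ(γ)⁻¹ and ρ(γ')⁻¹ past the maps P turns W(α) into W(γ')W(α)W(γ) = W(β), so the operator is [L:M]⁻¹
P_{mM} W(β) P_Mᵀ (`toMat_doubleCosetOp`). This depends only on β, whence the independence of the
decomposition. Its entry at (μ, γ) is w^{-n/2} times the sum of 𝐞(-b q_w(δ)) over δ ∈ A(w) with wδ =
γ and mδ = μ, where w = p^a and n is the rank (`proj_mul_tri_mul_transpose`). The two cases of the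
theorem are two ways of solving these conditions. -/

/-- The weight `1/2`, index `N/2` slash operator on functions on `ℍ × ℂ`; it raises the index by the
factor `det g`. -/
def jacobiSlash (N : ℂ) (g : MpGL) (F : ℍ → ℂ → ℂ) : ℍ → ℂ → ℂ := fun τ z =>
  (g.phi τ)⁻¹ *
    Complex.exp (-Real.pi * Complex.I * N * ((toGLReal g.mat).det.val : ℂ) *
      (toGLReal g.mat 1 0 : ℂ) * z ^ 2 / denom (toGLReal g.mat) τ) *
    F (toGLReal g.mat • τ) (((toGLReal g.mat).det.val : ℂ) * z / denom (toGLReal g.mat) τ)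

/-- The cocycle relation handles the factors φ and the argument of F. The Gaussian factors match
because c_{gh}/j_{gh} splits into a term from h and a term from g; the index of the outer slash is
already multiplied by det g. -/
lemma jacobiSlash_mul (N : ℂ) (g h : MpGL) (F : ℍ → ℂ → ℂ) :
    jacobiSlash (N * ((toGLReal g.mat).det.val : ℂ)) h (jacobiSlash N g F) =
      jacobiSlash N (g * h) F := by
  funext τ z
  have hj := MpGL.denom_mul g.mat h.mat τ
  have h0 := denom_ne_zero (toGLReal h.mat) τ
  have h1 := denom_ne_zero (toGLReal g.mat) (toGLReal h.mat • τ)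
  have hdet : ((toGLReal (g.mat * h.mat)).det.val : ℂ) =
      ((toGLReal g.mat).det.val : ℂ) * ((toGLReal h.mat).det.val : ℂ) := by
    rw [map_mul, map_mul]; push_cast; rfl
  have hdeth : ((toGLReal h.mat).det.val : ℂ) =
      (toGLReal h.mat 0 0 : ℂ) * (toGLReal h.mat 1 1 : ℂ) -
        (toGLReal h.mat 0 1 : ℂ) * (toGLReal h.mat 1 0 : ℂ) := by
    have : (toGLReal h.mat).det.val = (toGLReal h.mat).val.det := rfl
    rw [this, Matrix.det_fin_two]; push_cast; rfl
  have hc : (toGLReal (g.mat * h.mat) 1 0 : ℂ) =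
      (toGLReal g.mat 1 0 : ℂ) * (toGLReal h.mat 0 0 : ℂ) +
        (toGLReal g.mat 1 1 : ℂ) * (toGLReal h.mat 1 0 : ℂ) := by
    rw [map_mul, Matrix.GeneralLinearGroup.coe_mul, Matrix.mul_apply, Fin.sum_univ_two]
    push_cast; rfl
  have hjg : denom (toGLReal g.mat) ((toGLReal h.mat • τ : ℍ) : ℂ) * denom (toGLReal h.mat) τ =
      (toGLReal g.mat 1 0 : ℂ) * ((toGLReal h.mat 0 0 : ℂ) * τ + (toGLReal h.mat 0 1 : ℂ)) +
        (toGLReal g.mat 1 1 : ℂ) * denom (toGLReal h.mat) τ := by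
    have hs := coe_smul_of_det_pos (toGLReal_det_pos h.mat) τ
    have : denom (toGLReal g.mat) ((toGLReal h.mat • τ : ℍ) : ℂ) =
      (toGLReal g.mat 1 0 : ℂ) * ((toGLReal h.mat • τ : ℍ) : ℂ) + (toGLReal g.mat 1 1 : ℂ) := rfl
    rw [this, hs, num]
    field_simp
  have hjh : denom (toGLReal h.mat) τ = (toGLReal h.mat 1 0 : ℂ) * τ + (toGLReal h.mat 1 1 : ℂ) :=
    rfl
  simp only [jacobiSlash, MpGL.mul_phi, MpGL.mul_mat, hj, hdet, hc]
  rw [map_mul toGLReal, mul_smul]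
  generalize ((toGLReal g.mat).det.val : ℂ) = Dg at *
  generalize ((toGLReal h.mat).det.val : ℂ) = Dh at *
  generalize denom (toGLReal g.mat) ((toGLReal h.mat • τ : ℍ) : ℂ) = jg at *
  generalize hjj : denom (toGLReal h.mat) (τ : ℂ) = jh at *
  generalize (toGLReal g.mat 1 0 : ℂ) = cg at *
  generalize (toGLReal g.mat 1 1 : ℂ) = dg at *
  generalize (toGLReal h.mat 1 0 : ℂ) = ch at *
  generalize (toGLReal h.mat 1 1 : ℂ) = dh at *
  generalize (toGLReal h.mat 0 1 : ℂ) = bh at *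
  generalize (toGLReal h.mat 0 0 : ℂ) = ah at *
  have harg : Dg * (Dh * z / jh) / jg = Dg * Dh * z / (jg * jh) := by field_simp
  have hexp : -Real.pi * Complex.I * N * (Dg * Dh) * (cg * ah + dg * ch) * z ^ 2 / (jg * jh) =
      -Real.pi * Complex.I * (N * Dg) * Dh * ch * z ^ 2 / jh +
      -Real.pi * Complex.I * N * Dg * cg * (Dh * z / jh) ^ 2 / jg := by
    -- The lower row of gh gives c_{gh} j_h = c_h j_{gh} + c_g det h.
    have key : (cg * ah + dg * ch) * jh = ch * (jg * jh) + cg * Dh := by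
      rw [hjg, hdeth, hjh]; ring
    field_simp
    linear_combination (-(N * Dg * Dh * z ^ 2)) * key
  rw [harg, hexp, Complex.exp_add, mul_inv]
  ring

lemma jacobiSlash_one (N : ℂ) (F : ℍ → ℂ → ℂ) : jacobiSlash N 1 F = F := by
  funext τ z
  simp [jacobiSlash, denom]

lemma jacobiSlash_injective (N : ℂ) (g : MpGL) : Function.Injective (jacobiSlash N g) := by
  intro F F' h
  have := congrArg (jacobiSlash (N * ((toGLReal g.mat).det.val : ℂ)) g⁻¹) h
  rwa [jacobiSlash_mul, jacobiSlash_mul, mul_inv_cancel, jacobiSlash_one, jacobiSlash_one] at this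

/-! ### Discriminant forms of rank one and the character 𝐞 -/

/-- The quadratic form `r ↦ r² / (2 M) mod ℤ` on `ℤ / M`, for even `M`. -/
def zmodQuad (M : ℕ) (r : ZMod M) : AddCircle (1 : ℚ) := ((r.cast ^ 2 / (2 * M) : ℚ) : AddCircle _)

/-- The bilinear form `(r, s) ↦ r s / M mod ℤ` on `ℤ / M`. -/
def zmodBil (M : ℕ) (r s : ZMod M) : AddCircle (1 : ℚ) := ((r.cast * s.cast / M : ℚ) : AddCircle _)

lemma addCircle_coe_eq {x y : ℚ} (k : ℤ) (h : x - y = k) :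
    (x : AddCircle (1 : ℚ)) = (y : AddCircle (1 : ℚ)) := by
  rw [← sub_eq_zero, ← AddCircle.coe_sub, AddCircle.coe_eq_zero_iff]
  exact ⟨k, by simp [h]⟩

lemma zmod_cast_rat_eq (M : ℕ) (r : ℤ) [NeZero M] :
    ∃ k : ℤ, ((r : ZMod M).cast : ℚ) = r + M * k := by
  refine ⟨-(r / M), ?_⟩
  have h : ((r : ZMod M).cast : ℚ) = (((r : ZMod M).cast : ℤ) : ℚ) := by
    simp
  rw [h, ZMod.coe_intCast, Int.emod_def]
  push_cast; ring

/-- Replacing r by r + Mk changes r²/(2M) by rk + Mk²/2, an integer because M is even. -/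
lemma zmodQuad_intCast {M : ℕ} [NeZero M] (hM : Even M) (r : ℤ) :
    zmodQuad M (r : ZMod M) = ((r ^ 2 / (2 * M) : ℚ) : AddCircle (1 : ℚ)) := by
  obtain ⟨k, hk⟩ := zmod_cast_rat_eq M r
  obtain ⟨m, hm⟩ := hM
  rw [zmodQuad, hk]
  have hM0 : (M : ℚ) ≠ 0 := Nat.cast_ne_zero.2 (NeZero.ne M)
  have hmq : (M : ℚ) = m + m := by exact_mod_cast hm
  refine addCircle_coe_eq (r * k + m * k ^ 2) ?_
  push_cast
  have hm0 : (m : ℚ) ≠ 0 := fun h => hM0 (by rw [hmq, h, add_zero])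
  have h2 : (2 * M : ℚ) = 4 * m := by rw [hmq]; ring
  rw [h2, hmq]
  field_simp
  ring

lemma zmodBil_intCast {M : ℕ} [NeZero M] (r s : ℤ) :
    zmodBil M (r : ZMod M) (s : ZMod M) = ((r * s / M : ℚ) : AddCircle (1 : ℚ)) := by
  obtain ⟨k, hk⟩ := zmod_cast_rat_eq M r
  obtain ⟨m, hm⟩ := zmod_cast_rat_eq M s
  rw [zmodBil, hk, hm]
  have hM0 : (M : ℚ) ≠ 0 := Nat.cast_ne_zero.2 (NeZero.ne M)
  refine addCircle_coe_eq (r * m + s * k + M * k * m) ?_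
  push_cast
  field_simp
  ring

lemma expQZ_coe (x : ℚ) : expQZ (x : AddCircle (1 : ℚ)) =
    Complex.exp (2 * Real.pi * Complex.I * (x : ℂ)) := rfl

lemma expQZ_add (x y : AddCircle (1 : ℚ)) : expQZ (x + y) = expQZ x * expQZ y := by
  induction x using QuotientAddGroup.induction_on with | H x => ?_
  induction y using QuotientAddGroup.induction_on with | H y => ?_
  change expQZ ((x + y : ℚ) : AddCircle (1 : ℚ)) =
    expQZ (x : AddCircle (1 : ℚ)) * expQZ (y : AddCircle (1 : ℚ))
  rw [expQZ_coe, expQZ_coe, expQZ_coe, ← Complex.exp_add]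
  push_cast; ring_nf

@[simp] lemma expQZ_zero : expQZ 0 = 1 := by
  have := expQZ_coe 0
  simpa using this

lemma expQZ_sum {ι : Type*} (s : Finset ι) (f : ι → AddCircle (1 : ℚ)) :
    expQZ (∑ i ∈ s, f i) = ∏ i ∈ s, expQZ (f i) := by
  classical
  induction s using Finset.induction_on with
  | empty => simp
  | insert i s hi ih => rw [Finset.sum_insert hi, Finset.prod_insert hi, expQZ_add, ih]

lemma expQZ_eq_one_iff (x : AddCircle (1 : ℚ)) : expQZ x = 1 ↔ x = 0 := by
  refine ⟨fun h => ?_, fun h => by rw [h, expQZ_zero]⟩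
  induction x using QuotientAddGroup.induction_on with | H x => ?_
  change expQZ (x : AddCircle (1 : ℚ)) = 1 at h
  change (x : AddCircle (1 : ℚ)) = 0
  rw [expQZ_coe, Complex.exp_eq_one_iff] at h
  obtain ⟨n, hn⟩ := h
  rw [AddCircle.coe_eq_zero_iff]
  refine ⟨n, ?_⟩
  have h2 : (2 * Real.pi * Complex.I : ℂ) ≠ 0 := by simp [Real.pi_ne_zero]
  rw [mul_comm] at hn
  have := mul_right_cancel₀ h2 hn
  simp only [zsmul_eq_mul, mul_one]
  exact_mod_cast this.symm

lemma star_expQZ (x : AddCircle (1 : ℚ)) : starRingEnd ℂ (expQZ x) = expQZ (-x) := by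
  induction x using QuotientAddGroup.induction_on with | H x => ?_
  change starRingEnd ℂ (expQZ (x : AddCircle (1 : ℚ))) = expQZ ((-x : ℚ) : AddCircle (1 : ℚ))
  rw [expQZ_coe, expQZ_coe, ← Complex.exp_conj]
  congr 1
  simp [Complex.conj_ofNat]

/-! ### Theta series of level N and their linear independence -/

/-- The theta function `∑ f(r) 𝐞(τ r² / (2N) + r z)` attached to a function `f` on `ℤ / N`. -/
def thetaSeries (N : ℕ) (f : ZMod N → ℂ) : ℍ → ℂ → ℂ := fun τ z =>
  ∑' r : ℤ, f (r : ZMod N) * jacobiTheta₂_term r z (τ / N)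

lemma im_div_natCast_pos (N : ℕ) [NeZero N] (τ : ℍ) : 0 < ((τ : ℂ) / N).im := by
  rw [Complex.div_natCast_im]
  have : 0 < (N : ℝ) := Nat.cast_pos.2 (NeZero.pos N)
  exact div_pos τ.im_pos this

lemma summable_thetaSeries (N : ℕ) [NeZero N] (f : ZMod N → ℂ) (τ : ℍ) (z : ℂ) :
    Summable fun r : ℤ => f (r : ZMod N) * jacobiTheta₂_term r z (τ / N) := by
  have h := ((summable_jacobiTheta₂_term_iff z (τ / N)).2 (im_div_natCast_pos N τ)).norm
  refine Summable.of_norm_bounded (h.mul_left (∑ i, ‖f i‖)) fun r => ?_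
  rw [norm_mul]
  gcongr
  exact Finset.single_le_sum (f := fun i => ‖f i‖) (fun _ _ => norm_nonneg _) (Finset.mem_univ _)

lemma thetaSeries_sum {ι : Type*} (s : Finset ι) (N : ℕ) [NeZero N] (c : ι → ℂ)
    (f : ι → ZMod N → ℂ) (τ : ℍ) (z : ℂ) :
    thetaSeries N (∑ i ∈ s, c i • f i) τ z = ∑ i ∈ s, c i * thetaSeries N (f i) τ z := by
  simp only [thetaSeries, ← tsum_mul_left]
  rw [← Summable.tsum_finsetSum fun i _ => (summable_thetaSeries N (f i) τ z).mul_left _]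
  congr 1; funext r
  simp [Finset.sum_apply, Finset.sum_mul, mul_assoc]

lemma thetaSeries_smul (N : ℕ) (c : ℂ) (f : ZMod N → ℂ) (τ : ℍ) (z : ℂ) :
    thetaSeries N (c • f) τ z = c * thetaSeries N f τ z := by
  simp only [thetaSeries, ← tsum_mul_left]
  congr 1; funext r
  simp [mul_assoc]

lemma thetaSeries_eq_sum (N : ℕ) [NeZero N] (f : ZMod N → ℂ) (τ : ℍ) (z : ℂ) :
    thetaSeries N f τ z = ∑ j, f j * thetaSeries N (Pi.single j 1) τ z := by
  rw [← thetaSeries_sum]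
  congr 1
  funext k
  simp [Finset.sum_apply, Pi.single_apply]

lemma tsum_zmod_single (N : ℕ) [NeZero N] (j : ℤ) (g : ℤ → ℂ) :
    ∑' r : ℤ, (Pi.single (j : ZMod N) (1 : ℂ) : ZMod N → ℂ) (r : ZMod N) * g r =
      ∑' n : ℤ, g (j + N * n) := by
  have hinj : Function.Injective fun n : ℤ => j + N * n := by
    intro m n h
    have h0 : (N : ℤ) ≠ 0 := by exact_mod_cast NeZero.ne N
    exact mul_left_cancel₀ h0 (add_left_cancel h)
  rw [← hinj.tsum_eq]
  · congr 1; funext n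
    simp
  · intro r hr
    rw [Function.mem_support] at hr
    have : (r : ZMod N) = j := by
      by_contra h
      simp [h] at hr
    rw [ZMod.intCast_eq_intCast_iff_dvd_sub] at this
    obtain ⟨k, hk⟩ := this
    exact ⟨-k, by simp only; linarith [hk]⟩

lemma thetaSeries_single (N : ℕ) [NeZero N] (j : ℤ) (τ : ℍ) (z : ℂ) :
    thetaSeries N (Pi.single (j : ZMod N) 1) τ z =
      Complex.exp (2 * Real.pi * Complex.I * (τ * j ^ 2 / (2 * N) + j * z)) *
        jacobiTheta₂ (j * τ + N * z) (N * τ) := by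
  rw [thetaSeries, tsum_zmod_single N j fun r => jacobiTheta₂_term r z (τ / N), jacobiTheta₂,
    ← tsum_mul_left]
  congr 1; funext n
  have hN : (N : ℂ) ≠ 0 := Nat.cast_ne_zero.2 (NeZero.ne N)
  simp only [jacobiTheta₂_term]
  rw [← Complex.exp_add]
  congr 1
  push_cast
  field_simp
  ring

/-- Translating z by k/N multiplies the r-th term by 𝐞(kr/N). This both separates residue classes
and puts the image of a theta function under S in closed form. -/
lemma thetaSeries_char (N : ℕ) [NeZero N] (k : ℤ) (τ : ℍ) (z : ℂ) (f : ZMod N → ℂ) :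
    thetaSeries N (fun r => f r * expQZ (zmodBil N k r)) τ z = thetaSeries N f τ (z + k / N) := by
  simp only [thetaSeries]
  congr 1; funext r
  have hN : (N : ℂ) ≠ 0 := Nat.cast_ne_zero.2 (NeZero.ne N)
  rw [zmodBil_intCast, expQZ_coe, mul_assoc, jacobiTheta₂_term, jacobiTheta₂_term,
    ← Complex.exp_add]
  congr 2
  push_cast
  field_simp
  ring

lemma zmodBil_add_left {M : ℕ} [NeZero M] (r s t : ZMod M) :
    zmodBil M (r + s) t = zmodBil M r t + zmodBil M s t := by
  obtain ⟨r, rfl⟩ := ZMod.intCast_surjective r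
  obtain ⟨s, rfl⟩ := ZMod.intCast_surjective s
  obtain ⟨t, rfl⟩ := ZMod.intCast_surjective t
  rw [← Int.cast_add, zmodBil_intCast, zmodBil_intCast, zmodBil_intCast, ← AddCircle.coe_add]
  congr 1
  push_cast
  ring

lemma zmodBil_comm {M : ℕ} (r s : ZMod M) : zmodBil M r s = zmodBil M s r := by
  simp only [zmodBil, mul_comm]

lemma zmodBil_add_right {M : ℕ} [NeZero M] (r s t : ZMod M) :
    zmodBil M t (r + s) = zmodBil M t r + zmodBil M t s := by
  rw [zmodBil_comm, zmodBil_add_left, zmodBil_comm r, zmodBil_comm s]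

lemma zmodBil_one_eq_zero {M : ℕ} [NeZero M] {r : ZMod M} (h : zmodBil M r 1 = 0) : r = 0 := by
  obtain ⟨r, rfl⟩ := ZMod.intCast_surjective r
  have hM0 : (M : ℚ) ≠ 0 := Nat.cast_ne_zero.2 (NeZero.ne M)
  have h1 := zmodBil_intCast (M := M) r 1
  rw [Int.cast_one, h, eq_comm, AddCircle.coe_eq_zero_iff] at h1
  replace h := h1
  obtain ⟨n, hn⟩ := h
  rw [ZMod.intCast_zmod_eq_zero_iff_dvd]
  refine ⟨n, ?_⟩
  simp only [zsmul_eq_mul, mul_one, Int.cast_one] at hn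
  rw [eq_div_iff hM0] at hn
  have : (r : ℚ) = M * n := by linarith
  exact_mod_cast this

/-- The additive character `s ↦ 𝐞(r s / M)` of `ℤ / M`. -/
def zmodChar (M : ℕ) [NeZero M] (r : ZMod M) : AddChar (ZMod M) ℂ where
  toFun s := expQZ (zmodBil M r s)
  map_zero_eq_one' := by
    have h : zmodBil M r 0 = 0 := by simpa using zmodBil_add_right (0 : ZMod M) 0 r
    rw [h, expQZ_zero]
  map_add_eq_mul' s t := by rw [zmodBil_add_right, expQZ_add]

lemma sum_expQZ_zmodBil (M : ℕ) [NeZero M] (r : ZMod M) :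
    ∑ s, expQZ (zmodBil M r s) = if r = 0 then (M : ℂ) else 0 := by
  have h := AddChar.sum_eq_ite (zmodChar M r)
  have h1 : zmodChar M r = 0 ↔ r = 0 := by
    constructor
    · intro h
      have := congrArg (fun ψ => ψ 1) h
      exact zmodBil_one_eq_zero ((expQZ_eq_one_iff _).1 this)
    · rintro rfl
      ext s
      have h : zmodBil M 0 s = 0 := by simpa using zmodBil_add_left (0 : ZMod M) 0 s
      change expQZ (zmodBil M 0 s) = 1
      rw [h, expQZ_zero]
  simp only [h1, ZMod.card] at h
  exact h

/-- At τ = i and z = -ij/N the series is a nonzero factor times the theta constant at iN, which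
differs from its leading term 1 by less than 1. -/
lemma exists_thetaSeries_single_ne_zero (N : ℕ) [NeZero N] (j : ZMod N) :
    ∃ (τ : ℍ) (z : ℂ), thetaSeries N (Pi.single j 1) τ z ≠ 0 := by
  obtain ⟨j, rfl⟩ := ZMod.intCast_surjective j
  have hN : (N : ℂ) ≠ 0 := Nat.cast_ne_zero.2 (NeZero.ne N)
  refine ⟨UpperHalfPlane.I, -(j * Complex.I) / N, ?_⟩
  rw [thetaSeries_single]
  refine mul_ne_zero (Complex.exp_ne_zero _) ?_
  have h0 : (j * (UpperHalfPlane.I : ℍ) + N * (-(j * Complex.I) / N) : ℂ) = 0 := by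
    rw [UpperHalfPlane.coe_I]; field_simp; ring
  rw [h0, ← jacobiTheta_eq_jacobiTheta₂, UpperHalfPlane.coe_I]
  have him : ((N : ℂ) * Complex.I).im = N := by simp
  have hN1 : (1 : ℝ) ≤ N := by exact_mod_cast NeZero.one_le
  have hb := norm_jacobiTheta_sub_one_le (τ := (N : ℂ) * Complex.I) (by rw [him]; linarith)
  rw [him] at hb
  intro h
  rw [h] at hb
  have he : Real.exp (-Real.pi * N) < 1 / 4 := by
    have h1 : Real.exp (-Real.pi * N) ≤ Real.exp (-3) := by
      apply Real.exp_le_exp.2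
      nlinarith [Real.pi_gt_three]
    have h2 : Real.exp (-3) < 1 / 4 := by
      rw [Real.exp_neg, inv_eq_one_div]
      apply one_div_lt_one_div_of_lt (by norm_num)
      have := Real.add_one_lt_exp (x := 3) (by norm_num)
      linarith
    linarith
  have hpos := Real.exp_pos (-Real.pi * N)
  have : 2 / (1 - Real.exp (-Real.pi * N)) * Real.exp (-Real.pi * N) < 1 := by
    rw [div_mul_eq_mul_div, div_lt_one (by linarith)]
    linarith
  rw [zero_sub, norm_neg, norm_one] at hb
  linarith

/-- Averaging the translates by k/N against the characters of ℤ/N isolates f(j) times the j-th basic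
series, and that series is not identically zero. -/
lemma thetaSeries_injective (N : ℕ) [NeZero N] : Function.Injective (thetaSeries N) := by
  suffices ∀ f, (∀ τ z, thetaSeries N f τ z = 0) → f = 0 by
    intro f g hfg
    rw [← sub_eq_zero]
    refine this _ fun τ z => ?_
    have h := thetaSeries_sum Finset.univ N ![1, -1] ![f, g] τ z
    simp [Fin.sum_univ_two, hfg] at h
    rw [sub_eq_add_neg, h]
  intro f hf
  funext j
  obtain ⟨τ, z, hne⟩ := exists_thetaSeries_single_ne_zero N j
  have hN : (N : ℂ) ≠ 0 := Nat.cast_ne_zero.2 (NeZero.ne N)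
  have key : thetaSeries N (∑ k : ZMod N, expQZ (zmodBil N k (-j)) •
      fun r => f r * expQZ (zmodBil N k r)) τ z = 0 := by
    rw [thetaSeries_sum]
    refine Finset.sum_eq_zero fun k _ => ?_
    obtain ⟨k, rfl⟩ := ZMod.intCast_surjective k
    rw [thetaSeries_char, hf, mul_zero]
  have hfun : (∑ k : ZMod N, expQZ (zmodBil N k (-j)) • fun r => f r * expQZ (zmodBil N k r)) =
      (N * f j) • (Pi.single j 1 : ZMod N → ℂ) := by
    funext r
    have h1 : ∀ k, expQZ (zmodBil N k (-j)) * (f r * expQZ (zmodBil N k r)) =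
        f r * expQZ (zmodBil N (r - j) k) := by
      intro k
      rw [sub_eq_add_neg, zmodBil_comm (r + -j), zmodBil_add_right, expQZ_add]
      ring
    simp only [Finset.sum_apply, Pi.smul_apply, smul_eq_mul, h1, ← Finset.mul_sum,
      sum_expQZ_zmodBil, Pi.single_apply, sub_eq_zero]
    by_cases h : r = j
    · subst h; simp [mul_comm]
    · simp [h]
  rw [hfun, thetaSeries_smul] at key
  simpa [hN, hne] using key

/-! ### Matrices of the slash action on theta series -/

/-- The matrix `K` describes the slash action of `g`, of determinant `N' / N`, on theta functions. -/
def IsThetaMatrix (N N' : ℕ) (g : MpGL) (K : Matrix (ZMod N') (ZMod N) ℂ) [NeZero N] : Prop :=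
  (N' : ℂ) = N * ((toGLReal g.mat).det.val : ℂ) ∧
    ∀ f, jacobiSlash N g (thetaSeries N f) = thetaSeries N' (K *ᵥ f)

namespace IsThetaMatrix

variable {N N' N'' : ℕ} [NeZero N] [NeZero N'] {g h : MpGL}

lemma mul {K : Matrix (ZMod N') (ZMod N) ℂ} {K' : Matrix (ZMod N'') (ZMod N') ℂ}
    (hg : IsThetaMatrix N N' g K) (hh : IsThetaMatrix N' N'' h K') :
    IsThetaMatrix N N'' (g * h) (K' * K) := by
  refine ⟨?_, fun f => ?_⟩
  · rw [hh.1, hg.1, MpGL.mul_mat, map_mul, map_mul]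
    push_cast
    ring
  · rw [← jacobiSlash_mul, hg.2, ← hg.1, hh.2, Matrix.mulVec_mulVec]

lemma unique {K K' : Matrix (ZMod N') (ZMod N) ℂ}
    (hK : IsThetaMatrix N N' g K) (hK' : IsThetaMatrix N N' g K') : K = K' := by
  apply Matrix.mulVec_injective
  funext f
  exact thetaSeries_injective N' ((hK.2 f).symm.trans (hK'.2 f))

lemma one : IsThetaMatrix N N 1 1 :=
  ⟨by simp, fun f => by rw [jacobiSlash_one, Matrix.one_mulVec]⟩

lemma isUnit {K : Matrix (ZMod N) (ZMod N) ℂ} (hK : IsThetaMatrix N N g K) : IsUnit K := by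
  rw [← Matrix.mulVec_injective_iff_isUnit]
  intro f f' hff
  refine thetaSeries_injective N (jacobiSlash_injective N g ?_)
  rw [hK.2, hK.2]
  exact congrArg _ hff

/-- Equal source and target levels force det g = 1, so slashing back by g⁻¹ stays at level N. -/
lemma inv {K : Matrix (ZMod N) (ZMod N) ℂ} (hK : IsThetaMatrix N N g K) :
    IsThetaMatrix N N g⁻¹ K⁻¹ := by
  have hN : (N : ℂ) ≠ 0 := Nat.cast_ne_zero.2 (NeZero.ne N)
  have hdet : ((toGLReal g.mat).det.val : ℂ) = 1 := by
    have := hK.1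
    exact mul_left_cancel₀ hN (by rw [← this, mul_one])
  have hdet' : (N : ℂ) = N * ((toGLReal g⁻¹.mat).det.val : ℂ) := by
    have h : ((toGLReal g.mat).det.val : ℂ) * ((toGLReal g⁻¹.mat).det.val : ℂ) = 1 := by
      rw [← Complex.ofReal_mul, ← Units.val_mul, ← map_mul, ← map_mul]
      simp
    rw [hdet, one_mul] at h
    rw [h, mul_one]
  refine ⟨hdet', fun f => jacobiSlash_injective N g ?_⟩
  rw [hK.2, Matrix.mulVec_mulVec, Matrix.mul_nonsing_inv _ ((Matrix.isUnit_iff_isUnit_det _).1 hK.isUnit),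
    Matrix.one_mulVec]
  have h := jacobiSlash_mul N g⁻¹ g (thetaSeries N f)
  rwa [← hdet', inv_mul_cancel, jacobiSlash_one] at h

lemma of_single {K : Matrix (ZMod N') (ZMod N) ℂ}
    (h1 : (N' : ℂ) = N * ((toGLReal g.mat).det.val : ℂ))
    (h : ∀ (j : ℤ) (τ : ℍ) (z : ℂ), jacobiSlash N g (thetaSeries N (Pi.single (j : ZMod N) 1)) τ z =
      thetaSeries N' (fun i => K i j) τ z) : IsThetaMatrix N N' g K := by
  refine ⟨h1, fun f => ?_⟩
  funext τ z
  have hmv : K *ᵥ f = ∑ j, f j • fun i => K i j := by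
    funext i
    simp [Matrix.mulVec, dotProduct, Finset.sum_apply, mul_comm]
  rw [hmv, thetaSeries_sum, jacobiSlash, thetaSeries_eq_sum, Finset.mul_sum]
  refine Finset.sum_congr rfl fun j _ => ?_
  obtain ⟨j, rfl⟩ := ZMod.intCast_surjective j
  rw [← h, jacobiSlash]
  ring

end IsThetaMatrix

/-! ### The slash action of T, S and triangular elements -/

lemma triangular_det (x y z : ℚ) (c : ℝ) (hxz : 0 < x * z) (hc : c ^ 2 = z) :
    ((toGLReal (MpGL.triangular x y z c hxz hc).mat).det.val : ℂ) = x * z := by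
  simp [toGLReal, MpGL.triangular, Matrix.GeneralLinearGroup.mkOfDetNeZero, Matrix.det_fin_two]

lemma triangular_denom (x y z : ℚ) (c : ℝ) (hxz : 0 < x * z) (hc : c ^ 2 = z) (τ : ℂ) :
    denom (toGLReal (MpGL.triangular x y z c hxz hc).mat) τ = z := by
  simp [denom, toGLReal, MpGL.triangular, Matrix.GeneralLinearGroup.mkOfDetNeZero]

lemma triangular_smul (x y z : ℚ) (c : ℝ) (hxz : 0 < x * z) (hc : c ^ 2 = z) (τ : ℍ) :
    ((toGLReal (MpGL.triangular x y z c hxz hc).mat • τ : ℍ) : ℂ) = (x * τ + y) / z := by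
  rw [coe_smul_of_det_pos (toGLReal_det_pos _), triangular_denom]
  simp [num, toGLReal, MpGL.triangular, Matrix.GeneralLinearGroup.mkOfDetNeZero]

lemma jacobiSlash_triangular (N : ℂ) (x y z : ℚ) (c : ℝ) (hxz : 0 < x * z) (hc : c ^ 2 = z)
    (F : ℍ → ℂ → ℂ) (τ : ℍ) (t : ℂ) :
    jacobiSlash N (MpGL.triangular x y z c hxz hc) F τ t = (c : ℂ)⁻¹ *
      F (toGLReal (MpGL.triangular x y z c hxz hc).mat • τ) (x * t) := by
  have h10 : (toGLReal (MpGL.triangular x y z c hxz hc).mat 1 0 : ℂ) = 0 := by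
    simp [toGLReal, MpGL.triangular, Matrix.GeneralLinearGroup.mkOfDetNeZero]
  have hz : (z : ℂ) ≠ 0 := by
    have : z ≠ 0 := fun h => by simp [h] at hxz
    exact_mod_cast this
  rw [jacobiSlash, h10, triangular_denom, triangular_det]
  have : (x * z * t / z : ℂ) = x * t := by field_simp
  rw [this]
  simp [MpGL.triangular]

lemma jacobiTheta₂_term_add_rat (r : ℤ) (z τ : ℂ) (q : ℚ) (h : ℂ) (hh : h = (r : ℂ) ^ 2 * q / 2) (τ' : ℂ)
    (hτ : τ' = τ + q) :
    jacobiTheta₂_term r z τ' = Complex.exp (2 * Real.pi * Complex.I * h) * jacobiTheta₂_term r z τ := by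
  rw [jacobiTheta₂_term, jacobiTheta₂_term, ← Complex.exp_add, hh, hτ]
  congr 1
  ring

/-- The action of `T` on theta functions. -/
def thetaMatrixT (N : ℕ) : Matrix (ZMod N) (ZMod N) ℂ :=
  Matrix.diagonal fun r => expQZ (zmodQuad N r)

lemma isThetaMatrix_T {N : ℕ} [NeZero N] (hN : Even N) :
    IsThetaMatrix N N mpT (thetaMatrixT N) := by
  refine ⟨?_, fun f => ?_⟩
  · have := triangular_det 1 1 1 1 (by norm_num) (by norm_num)
    change _ = _ * ((toGLReal (MpGL.triangular 1 1 1 1 (by norm_num) (by norm_num)).mat).det.val : ℂ)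
    rw [this]; simp
  · funext τ z
    change jacobiSlash N (MpGL.triangular 1 1 1 1 (by norm_num) (by norm_num)) _ τ z = _
    rw [jacobiSlash_triangular, thetaSeries, thetaSeries, triangular_smul]
    simp only [Complex.ofReal_one, inv_one, one_mul, Rat.cast_one, div_one]
    congr 1; funext r
    have hN0 : (N : ℂ) ≠ 0 := Nat.cast_ne_zero.2 (NeZero.ne N)
    rw [jacobiTheta₂_term_add_rat r z (τ / N) (1 / N) ((r : ℂ) ^ 2 / (2 * N))
      (by push_cast; field_simp) _ (by push_cast; field_simp), thetaMatrixT,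
      Matrix.mulVec_diagonal, zmodQuad_intCast hN, expQZ_coe]
    push_cast
    ring

/-- The action of `S` on theta functions. -/
def thetaMatrixS (N : ℕ) : Matrix (ZMod N) (ZMod N) ℂ := fun i j =>
  expQZ ((-1 / 8 : ℚ) : AddCircle (1 : ℚ)) / (Real.sqrt N : ℂ) * expQZ (-zmodBil N i j)

lemma toGLReal_mpS : (toGLReal (mpS : MpGL).mat : Matrix (Fin 2) (Fin 2) ℝ) = !![0, -1; 1, 0] := by
  have h : ((ModularGroup.S.map (Int.castRingHom ℚ) : SL(2, ℚ)) : Matrix (Fin 2) (Fin 2) ℚ)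
      = !![0, -1; 1, 0] := by
    rw [Matrix.SpecialLinearGroup.map_apply_coe, ModularGroup.coe_S]
    ext i j
    fin_cases i <;> fin_cases j <;> simp
  ext i j
  fin_cases i <;> fin_cases j <;> simp [toGLReal, mpS, h]

lemma mpS_det : ((toGLReal (mpS : MpGL).mat).det.val : ℂ) = 1 := by
  have : (toGLReal (mpS : MpGL).mat).det.val = (toGLReal (mpS : MpGL).mat).val.det := rfl
  rw [this, toGLReal_mpS]; simp

lemma mpS_denom (τ : ℂ) : denom (toGLReal (mpS : MpGL).mat) τ = τ := by
  simp [denom, toGLReal_mpS]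

lemma mpS_smul (τ : ℍ) : ((toGLReal (mpS : MpGL).mat • τ : ℍ) : ℂ) = -1 / τ := by
  rw [coe_smul_of_det_pos (toGLReal_det_pos _), mpS_denom]
  simp [num, toGLReal_mpS]

/-- The factor 𝐞(-1/8) compares √(-iτ) with √τ. Since arg τ lies in [0, π], subtracting π/2 does not
leave the principal range, so the logarithms add. -/
lemma cpow_half_mul (N : ℕ) [NeZero N] (τ : ℍ) :
    expQZ ((-1 / 8 : ℚ) : AddCircle (1 : ℚ)) / (Real.sqrt N : ℂ) *
      (1 / (-Complex.I * ((τ : ℂ) / N)) ^ (1 / 2 : ℂ)) = ((τ : ℂ) ^ (1 / 2 : ℂ))⁻¹ := by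
  have hNr : 0 < (N : ℝ) := Nat.cast_pos.2 (NeZero.pos N)
  have hN : (N : ℂ) ≠ 0 := Nat.cast_ne_zero.2 (NeZero.ne N)
  have hτ : (τ : ℂ) ≠ 0 := ne_zero τ
  have harg1 := Complex.arg_nonneg_iff.2 τ.im_pos.le
  have harg2 := Complex.arg_le_pi (τ : ℂ)
  have hpi := Real.pi_pos
  have h1 : (-Complex.I * ((τ : ℂ) / N)) = ((1 / N : ℝ) : ℂ) * (-Complex.I * τ) := by
    push_cast; field_simp
  have hI : (-Complex.I) ≠ 0 := neg_ne_zero.2 Complex.I_ne_zero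
  have hlog : Complex.log (-Complex.I * τ) = -(Real.pi / 2) * Complex.I + Complex.log τ := by
    rw [Complex.log_mul hI hτ, Complex.log_neg_I]
    rw [Complex.arg_neg_I]
    constructor <;> linarith
  have hs : ((Real.sqrt N : ℝ) : ℂ) = Complex.exp (Real.log N / 2) := by
    rw [Real.sqrt_eq_rpow, Real.rpow_def_of_pos hNr]
    push_cast
    congr 1
    ring
  rw [h1, Complex.cpow_def_of_ne_zero (mul_ne_zero (by
      exact_mod_cast (one_div_pos.2 hNr).ne') (mul_ne_zero hI hτ)),
    Complex.log_ofReal_mul (one_div_pos.2 hNr) (mul_ne_zero hI hτ), hlog,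
    Complex.cpow_def_of_ne_zero hτ, expQZ_coe, hs, one_div, ← Complex.exp_neg, ← Complex.exp_neg,
    ← Complex.exp_sub, ← Complex.exp_add, one_div, Real.log_inv]
  congr 1
  push_cast
  ring

/-- This is the functional equation of θ. The j-th column is a multiple of a character, so its
series is θ(z - j/N, τ/N), and inverting τ/N gives the j-th basic series at -1/τ up to a Gaussian
factor. -/
lemma isThetaMatrix_S (N : ℕ) [NeZero N] : IsThetaMatrix N N mpS (thetaMatrixS N) := by
  refine IsThetaMatrix.of_single (by rw [mpS_det, mul_one]) fun j τ z => ?_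
  have hN : (N : ℂ) ≠ 0 := Nat.cast_ne_zero.2 (NeZero.ne N)
  have hτ : (τ : ℂ) ≠ 0 := ne_zero τ
  have h10 : (toGLReal (mpS : MpGL).mat 1 0 : ℂ) = 1 := by simp [toGLReal_mpS]
  have hcol : (fun i => thetaMatrixS N i j) =
      (expQZ ((-1 / 8 : ℚ) : AddCircle (1 : ℚ)) / (Real.sqrt N : ℂ)) •
        fun r => (1 : ZMod N → ℂ) r * expQZ (zmodBil N ((-j : ℤ) : ZMod N) r) := by
    funext i
    obtain ⟨i, rfl⟩ := ZMod.intCast_surjective i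
    simp only [thetaMatrixS, Pi.smul_apply, Pi.one_apply, smul_eq_mul, one_mul, zmodBil_intCast]
    rw [← AddCircle.coe_neg]
    congr 4
    push_cast
    ring
  have hone : thetaSeries N 1 τ (z + ((-j : ℤ) : ℂ) / N) =
      jacobiTheta₂ (z + ((-j : ℤ) : ℂ) / N) (τ / N) := by
    simp [thetaSeries, jacobiTheta₂]
  rw [hcol, thetaSeries_smul, thetaSeries_char, hone, jacobiTheta₂_functional_equation,
    jacobiSlash, thetaSeries_single, h10, mpS_denom, mpS_smul, mpS_det]
  change ((τ : ℂ) ^ (1 / 2 : ℂ))⁻¹ * _ * _ = _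
  rw [← cpow_half_mul N τ]
  have e1 : (z + ((-j : ℤ) : ℂ) / N) / (τ / N) = j * (-1 / τ) + N * (1 * z / τ) := by
    push_cast; field_simp; ring
  have e2 : (-1 / ((τ : ℂ) / N)) = N * (-1 / τ) := by field_simp
  rw [e1, e2]
  have e3 : Complex.exp (-Real.pi * Complex.I * (z + ((-j : ℤ) : ℂ) / N) ^ 2 / (τ / N)) =
      Complex.exp (-Real.pi * Complex.I * N * 1 * 1 * z ^ 2 / τ) *
      Complex.exp (2 * Real.pi * Complex.I * (-1 / τ * j ^ 2 / (2 * N) + j * (1 * z / τ))) := by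
    rw [← Complex.exp_add]
    congr 1
    push_cast; field_simp; ring
  rw [e3]
  ring

/-- The action of `((u b; 0 w), c)` on theta functions, from level `N` to level `N * (u * w)`. -/
def thetaMatrixTri (N N' u w : ℕ) [NeZero (N * w)] (b : ℤ) (c : ℝ) : Matrix (ZMod N') (ZMod N) ℂ :=
  fun s j => ∑ r : ZMod (N * w), if (r.cast : ZMod N) = j ∧ ((u * r.val : ℕ) : ZMod N') = s then
    (c : ℂ)⁻¹ * expQZ (b • zmodQuad (N * w) r) else 0

/-- At ((uτ+b)/w, uz) the r-th term of level N equals 𝐞(b r²/(2Nw)) times the term of index ur of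
level N·uw. The coefficient depends on r mod Nw, and this class determines both r mod N and ur mod
N·uw. -/
lemma isThetaMatrix_tri {N N' u w : ℕ} [NeZero N] [NeZero (N * w)] (hN : Even N) [NeZero w]
    [NeZero u] (hN' : N' = N * (u * w)) (b : ℤ) (c : ℝ) (hxz : (0 : ℚ) < u * w)
    (hc : c ^ 2 = (w : ℚ)) :
    IsThetaMatrix N N' (MpGL.triangular u b w c hxz hc) (thetaMatrixTri N N' u w b c) := by
  have hN0 : (N : ℂ) ≠ 0 := Nat.cast_ne_zero.2 (NeZero.ne N)
  have hu0 : (u : ℂ) ≠ 0 := Nat.cast_ne_zero.2 (NeZero.ne u)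
  have hw0 : (w : ℂ) ≠ 0 := Nat.cast_ne_zero.2 (NeZero.ne w)
  refine ⟨by rw [triangular_det, hN']; push_cast; ring, fun f => ?_⟩
  funext τ z
  rw [jacobiSlash_triangular, thetaSeries, thetaSeries, triangular_smul, ← tsum_mul_left]
  have hinj : Function.Injective fun r : ℤ => (u : ℤ) * r :=
    fun m n h => mul_left_cancel₀ (by exact_mod_cast NeZero.ne u) h
  have hval : ∀ s : ZMod N', (thetaMatrixTri N N' u w b c *ᵥ f) s = ∑ r : ZMod (N * w),
      if ((u * r.val : ℕ) : ZMod N') = s then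
        (c : ℂ)⁻¹ * expQZ (b • zmodQuad (N * w) r) * f r.cast else 0 := by
    intro s
    simp only [Matrix.mulVec, dotProduct, thetaMatrixTri, Finset.sum_mul]
    rw [Finset.sum_comm]
    refine Finset.sum_congr rfl fun r _ => ?_
    rw [Finset.sum_eq_single (r.cast : ZMod N)]
    · simp
    · intro j _ hj
      rw [if_neg fun h => hj h.1.symm, zero_mul]
    · simp
  have hdvd : ∀ (r : ZMod (N * w)) (s : ℤ), ((u * r.val : ℕ) : ZMod N') = (s : ZMod N') ↔
      ∃ k : ℤ, s = u * k ∧ r = k := by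
    intro r s
    constructor
    · intro h
      rw [← Int.cast_natCast, ZMod.intCast_eq_intCast_iff_dvd_sub] at h
      obtain ⟨m, hm⟩ := h
      refine ⟨r.val + N * w * m, ?_, ?_⟩
      · rw [hN'] at hm; push_cast at hm; linear_combination hm
      · push_cast
        have : ((N : ZMod (N * w)) * w) = 0 := by exact_mod_cast ZMod.natCast_self (N * w)
        rw [this]; simp
    · rintro ⟨k, rfl, rfl⟩
      rw [← Int.cast_natCast, ZMod.intCast_eq_intCast_iff_dvd_sub]
      refine ⟨k / (N * w : ℕ), ?_⟩
      rw [Nat.cast_mul, ZMod.val_intCast, Int.emod_def, hN']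
      push_cast
      ring
  -- The coefficients of level N' vanish off the multiples of u, so the sum over s may be reindexed
  -- by s = ur.
  rw [← hinj.tsum_eq (f := fun s : ℤ => (thetaMatrixTri N N' u w b c *ᵥ f) (s : ZMod N') *
    jacobiTheta₂_term s z (τ / N'))]
  · congr 1; funext r
    have hs : (thetaMatrixTri N N' u w b c *ᵥ f) (((u : ℤ) * r : ℤ) : ZMod N') =
        (c : ℂ)⁻¹ * expQZ (b • zmodQuad (N * w) r) * f r := by
      rw [hval, Finset.sum_eq_single (r : ZMod (N * w))]
      · rw [if_pos ((hdvd _ _).2 ⟨r, rfl, rfl⟩)]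
        congr 2
        exact ZMod.cast_intCast (dvd_mul_right N w) r
      · intro k _ hk
        rw [if_neg]
        intro h
        obtain ⟨m, hm, rfl⟩ := (hdvd _ _).1 h
        exact hk (by rw [hinj hm])
      · simp
    rw [hs, zmodQuad_intCast (hN.mul_right w), ← AddCircle.coe_zsmul, expQZ_coe,
      jacobiTheta₂_term, jacobiTheta₂_term]
    rw [mul_right_comm (c : ℂ)⁻¹, mul_assoc _ (Complex.exp _), ← Complex.exp_add, ← mul_assoc]
    congr 2
    rw [hN', zsmul_eq_mul]
    push_cast
    field_simp
    ring
  · intro s hs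
    rw [Function.mem_support] at hs
    by_contra hcon
    apply hs
    rw [hval, Finset.sum_eq_zero, zero_mul]
    intro r _
    rw [if_neg]
    intro h
    obtain ⟨k, hk, -⟩ := (hdvd _ _).1 h
    exact hcon ⟨k, hk.symm⟩

/-! ## Generation of the metaplectic group -/

/-- Two continuous nowhere vanishing square roots of one function on the connected space ℍ agree up
to a global sign. -/
lemma MpGL.phi_eq_or_neg {g h : MpGL} (hgh : g.mat = h.mat) :
    g.phi = h.phi ∨ g.phi = -h.phi := by
  have hcg : Continuous g.phi := g.holo.continuous
  have hch : Continuous h.phi := h.holo.continuous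
  have := isPreconnected_univ.eq_or_eq_neg_of_sq_eq (S := (Set.univ : Set ℍ)) (f := g.phi)
    (g := h.phi) hcg.continuousOn hch.continuousOn
    (fun τ _ => by simp only [Pi.pow_apply, g.sq, h.sq, hgh]) (fun {τ} _ => h.phi_ne_zero τ)
  simpa [Set.eqOn_univ] using this

lemma exists_closure_mat_eq (M : SL(2, ℤ)) :
    ∃ h ∈ Subgroup.closure {mpT, mpS},
      (h : MpGL).mat = Matrix.SpecialLinearGroup.toGLPos (M.map (Int.castRingHom ℚ)) := by
  have hM : M ∈ Subgroup.closure {ModularGroup.S, ModularGroup.T} := by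
    rw [SpecialLinearGroup.SL2Z_generators]; trivial
  induction hM using Subgroup.closure_induction with
  | mem x hx =>
    rcases hx with rfl | rfl
    · exact ⟨mpS, Subgroup.subset_closure (by simp), rfl⟩
    · refine ⟨mpT, Subgroup.subset_closure (by simp), ?_⟩
      obtain ⟨M, hM⟩ := mpT.2
      rw [hM]
      congr 2
      apply Subtype.ext
      have h : ∀ i j, ((M i j : ℤ) : ℚ) = !![(1 : ℚ), 1; 0, 1] i j := by
        intro i j
        have := congrArg (fun X : GL(2, ℚ)⁺ => (X : GL (Fin 2) ℚ).val i j) hM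
        simp only [Matrix.SpecialLinearGroup.coe_GLPos_coe_GL_coe_matrix,
          Matrix.SpecialLinearGroup.map_apply_coe] at this
        exact this.symm
      rw [ModularGroup.coe_T]
      ext i j
      have := h i j
      fin_cases i <;> fin_cases j <;> simpa using this
  | one => exact ⟨1, one_mem _, by simp⟩
  | mul x y _ _ hx hy =>
    obtain ⟨g, hg, hgx⟩ := hx
    obtain ⟨h, hh, hhy⟩ := hy
    exact ⟨g * h, mul_mem hg hh, by simp [hgx, hhy]⟩
  | inv x _ hx =>
    obtain ⟨g, hg, hgx⟩ := hx
    refine ⟨g⁻¹, inv_mem hg, ?_⟩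
    rw [Subgroup.coe_inv, MpGL.inv_mat, hgx, ← map_inv, ← map_inv]

/-- The element is S⁴: S² acts trivially on ℍ and its φ squares to -1, so S⁴ has trivial matrix and
φ = -1. -/
lemma exists_closure_neg_one :
    ∃ h ∈ Subgroup.closure {mpT, mpS}, (h : MpGL).mat = 1 ∧ ∀ τ, (h : MpGL).phi τ = -1 := by
  have hS : mpS ∈ Subgroup.closure {mpT, mpS} := Subgroup.subset_closure (by simp)
  have hsq : (toGLReal (mpS * mpS : MpGL).mat : Matrix (Fin 2) (Fin 2) ℝ) = -1 := by
    rw [MpGL.mul_mat, map_mul, Matrix.GeneralLinearGroup.coe_mul, toGLReal_mpS]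
    ext i j
    fin_cases i <;> fin_cases j <;> simp
  have hsmul : ∀ τ : ℍ, toGLReal (mpS * mpS : MpGL).mat • τ = τ := by
    intro τ
    apply UpperHalfPlane.ext
    rw [coe_smul_of_det_pos (toGLReal_det_pos _), num, denom, hsq]
    simp
  refine ⟨mpS * mpS * (mpS * mpS), mul_mem (mul_mem hS hS) (mul_mem hS hS), ?_, fun τ => ?_⟩
  · have h4 : ModularGroup.S * ModularGroup.S * (ModularGroup.S * ModularGroup.S) = 1 := by decide
    have := congrArg (fun M : SL(2, ℤ) =>
      Matrix.SpecialLinearGroup.toGLPos (M.map (Int.castRingHom ℚ))) h4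
    simp only [map_mul, map_one] at this
    exact this
  · change (mpS * mpS : MpGL).phi (toGLReal (mpS * mpS : MpGL).mat • τ) * (mpS * mpS : MpGL).phi τ = -1
    rw [hsmul, ← sq, (mpS * mpS : MpGL).sq, denom, hsq]
    simp

/-- The matrices S and T generate SL₂(ℤ), and the only remaining ambiguity is the sign of φ, which
S⁴ corrects. -/
lemma closure_mpT_mpS : Subgroup.closure {mpT, mpS} = ⊤ := by
  rw [eq_top_iff]
  rintro g -
  obtain ⟨M, hM⟩ := g.2
  obtain ⟨h, hh, hhM⟩ := exists_closure_mat_eq M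
  obtain ⟨k, hk, hk1, hkphi⟩ := exists_closure_neg_one
  have hmat : (g : MpGL).mat = (h : MpGL).mat := by rw [hM, hhM]
  rcases MpGL.phi_eq_or_neg hmat with h1 | h1
  · have : g = h := Subtype.ext (MpGL.ext hmat h1)
    rwa [this]
  · have : g = k * h := by
      refine Subtype.ext (MpGL.ext ?_ ?_)
      · rw [Subgroup.coe_mul, MpGL.mul_mat, hk1, one_mul, hmat]
      · funext τ
        rw [Subgroup.coe_mul, MpGL.mul_phi, hkphi, h1]
        simp
    rw [this]
    exact mul_mem hk hh

lemma exists_isThetaMatrix {N : ℕ} [NeZero N] (hN : Even N) (g : Mp2Z) :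
    ∃ K, IsThetaMatrix N N g K := by
  have hg : g ∈ Subgroup.closure {mpT, mpS} := by rw [closure_mpT_mpS]; trivial
  induction hg using Subgroup.closure_induction with
  | mem x hx =>
    rcases hx with rfl | rfl
    · exact ⟨_, isThetaMatrix_T hN⟩
    · exact ⟨_, isThetaMatrix_S N⟩
  | one => exact ⟨_, IsThetaMatrix.one⟩
  | mul x y _ _ hx hy =>
    obtain ⟨K, hK⟩ := hx
    obtain ⟨K', hK'⟩ := hy
    exact ⟨_, hK.mul hK'⟩
  | inv x _ hx =>
    obtain ⟨K, hK⟩ := hx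
    exact ⟨_, hK.inv⟩

/-! ## Tensor products of theta matrices -/

section Tensor

variable {ι : Type*} [Fintype ι] [DecidableEq ι]

/-- The tensor product of a family of matrices. -/
def piMatrix {A B : ι → Type*} (K : ∀ i, Matrix (A i) (B i) ℂ) : Matrix (∀ i, A i) (∀ i, B i) ℂ :=
  fun s t => ∏ i, K i (s i) (t i)

/-- Interchanging product and sum. As the twists are ring homomorphisms, tensor theta matrices
therefore compose as the single factors do. -/
lemma piMatrix_mul {A B C : ι → Type*} [∀ i, Fintype (B i)] (K' : ∀ i, Matrix (A i) (B i) ℂ)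
    (K : ∀ i, Matrix (B i) (C i) ℂ) :
    piMatrix (fun i => K' i * K i) = piMatrix K' * piMatrix K := by
  ext s t
  simp only [piMatrix, Matrix.mul_apply, ← Finset.prod_mul_distrib]
  rw [Finset.prod_univ_sum, Fintype.piFinset_univ]

lemma piMatrix_diagonal {A : ι → Type*} [∀ i, DecidableEq (A i)] (d : ∀ i, A i → ℂ) :
    piMatrix (fun i => Matrix.diagonal (d i)) = Matrix.diagonal fun s => ∏ i, d i (s i) := by
  ext s t
  by_cases h : s = t
  · subst h; simp [piMatrix]
  · obtain ⟨i, hi⟩ := Function.ne_iff.1 h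
    rw [Matrix.diagonal_apply_ne _ h, piMatrix]
    exact Finset.prod_eq_zero (Finset.mem_univ i) (Matrix.diagonal_apply_ne _ hi)

lemma piMatrix_one {A : ι → Type*} [∀ i, DecidableEq (A i)] :
    piMatrix (fun i => (1 : Matrix (A i) (A i) ℂ)) = 1 := by
  have := piMatrix_diagonal (A := A) fun i _ => 1
  simpa using this

/-- The matrix `W` is the tensor product of the matrices describing the slash action of `g` on theta
functions of levels `N i`, the factors being twisted by the field endomorphisms `σ i`. -/
def IsTensorThetaMatrix (σ : ι → ℂ →+* ℂ) (N N' : ι → ℕ) [∀ i, NeZero (N i)] (g : MpGL)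
    (W : Matrix (∀ i, ZMod (N' i)) (∀ i, ZMod (N i)) ℂ) : Prop :=
  ∃ K : ∀ i, Matrix (ZMod (N' i)) (ZMod (N i)) ℂ, (∀ i, IsThetaMatrix (N i) (N' i) g (K i)) ∧
    W = piMatrix fun i => (K i).map (σ i)

namespace IsTensorThetaMatrix

variable {σ : ι → ℂ →+* ℂ} {N N' N'' : ι → ℕ} [∀ i, NeZero (N i)] [∀ i, NeZero (N' i)] {g h : MpGL}

lemma mul {W : Matrix (∀ i, ZMod (N' i)) (∀ i, ZMod (N i)) ℂ}
    {W' : Matrix (∀ i, ZMod (N'' i)) (∀ i, ZMod (N' i)) ℂ}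
    (hg : IsTensorThetaMatrix σ N N' g W) (hh : IsTensorThetaMatrix σ N' N'' h W') :
    IsTensorThetaMatrix σ N N'' (g * h) (W' * W) := by
  obtain ⟨K, hK, rfl⟩ := hg
  obtain ⟨K', hK', rfl⟩ := hh
  refine ⟨fun i => K' i * K i, fun i => (hK i).mul (hK' i), ?_⟩
  simp only [Matrix.map_mul]
  rw [piMatrix_mul]

/-- This uniqueness is the source of all independence statements: any two factorizations of g in
`MpGL` yield the same W. -/
lemma unique {W W' : Matrix (∀ i, ZMod (N' i)) (∀ i, ZMod (N i)) ℂ}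
    (hW : IsTensorThetaMatrix σ N N' g W) (hW' : IsTensorThetaMatrix σ N N' g W') : W = W' := by
  obtain ⟨K, hK, rfl⟩ := hW
  obtain ⟨K', hK', rfl⟩ := hW'
  have : K = K' := funext fun i => (hK i).unique (hK' i)
  rw [this]

lemma one : IsTensorThetaMatrix σ N N 1 1 := by
  refine ⟨fun _ => 1, fun _ => IsThetaMatrix.one, ?_⟩
  simp [Matrix.map_one, piMatrix_one]

end IsTensorThetaMatrix

end Tensor

/-! ## Orthogonal frames in even lattices -/

namespace EvenLattice

variable {V : Type*} [AddCommGroup V] [Module ℚ V]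

/-- An orthogonal basis of `V` consisting of vectors of `L`. -/
structure Frame (L : EvenLattice V) (ι : Type*) where
  v : Module.Basis ι ℚ V
  N : ι → ℕ
  ε : ι → ℤˣ
  pos : ∀ i, NeZero (N i)
  even : ∀ i, Even (N i)
  ortho : ∀ i j, i ≠ j → L.form (v i) (v j) = 0
  self : ∀ i, L.form (v i) (v i) = ((ε i : ℤ) : ℚ) * N i
  mem : ∀ i, v i ∈ L.carrier

attribute [instance] Frame.pos

/-- The vector `x` lies in the coset `γ`. -/
def InCoset (L : EvenLattice V) (γ : L.Disc) (x : V) : Prop :=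
  ∃ h : x ∈ L.dual, (Submodule.Quotient.mk ⟨x, h⟩ : L.Disc) = γ

variable {L : EvenLattice V}

lemma carrier_le_dual : L.carrier ≤ L.dual := by
  intro x hx
  rw [mem_dual]
  intro y hy
  obtain ⟨k, hk⟩ := L.even _ (add_mem hx hy)
  obtain ⟨m, hm⟩ := L.even _ hx
  obtain ⟨n, hn⟩ := L.even _ hy
  have hs := L.symm.eq x y
  refine ⟨k - m - n, ?_⟩
  simp only [map_add, LinearMap.add_apply] at hk
  push_cast
  linarith

lemma exists_inCoset (γ : L.Disc) : ∃ x, L.InCoset γ x := by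
  obtain ⟨x, rfl⟩ := Submodule.Quotient.mk_surjective _ γ
  exact ⟨x, x.2, rfl⟩

lemma InCoset.eq_iff {γ δ : L.Disc} {x y : V} (hx : L.InCoset γ x) (hy : L.InCoset δ y) :
    γ = δ ↔ x - y ∈ L.carrier := by
  obtain ⟨hx, rfl⟩ := hx
  obtain ⟨hy, rfl⟩ := hy
  rw [Submodule.Quotient.eq]
  rfl

lemma InCoset.congr {γ : L.Disc} {x y : V} (hx : L.InCoset γ x) (h : y - x ∈ L.carrier) :
    L.InCoset γ y := by
  have hy : y ∈ L.dual := by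
    have := add_mem (carrier_le_dual h) hx.1
    simpa using this
  have hy' : L.InCoset (Submodule.Quotient.mk ⟨y, hy⟩) y := ⟨hy, rfl⟩
  rwa [(hy'.eq_iff hx).2 h] at hy'

lemma inCoset_mk {x : V} (hx : x ∈ L.dual) : L.InCoset (Submodule.Quotient.mk ⟨x, hx⟩) x :=
  ⟨hx, rfl⟩

lemma inCoset_zero {x : V} (hx : x ∈ L.carrier) : L.InCoset 0 x := by
  have h0 : L.InCoset 0 0 := ⟨zero_mem _, rfl⟩
  exact h0.congr (by simpa using hx)

lemma InCoset.add {γ δ : L.Disc} {x y : V} (hx : L.InCoset γ x) (hy : L.InCoset δ y) :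
    L.InCoset (γ + δ) (x + y) := by
  obtain ⟨hx, rfl⟩ := hx
  obtain ⟨hy, rfl⟩ := hy
  exact ⟨add_mem hx hy, rfl⟩

lemma InCoset.nsmul {γ : L.Disc} {x : V} (hx : L.InCoset γ x) (n : ℕ) :
    L.InCoset (n • γ) (n • x) := by
  obtain ⟨hx, rfl⟩ := hx
  exact ⟨L.dual.smul_of_tower_mem n hx, rfl⟩

lemma InCoset.bil {γ δ : L.Disc} {x y : V} (hx : L.InCoset γ x) (hy : L.InCoset δ y) :
    L.bil γ δ = ((L.form x y : ℚ) : AddCircle (1 : ℚ)) := by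
  obtain ⟨hx, rfl⟩ := hx
  obtain ⟨hy, rfl⟩ := hy
  rfl

lemma InCoset.q {γ : L.Disc} {x : V} (hx : L.InCoset γ x) :
    L.q γ = ((L.form x x / 2 : ℚ) : AddCircle (1 : ℚ)) := by
  obtain ⟨hx, rfl⟩ := hx
  rfl

namespace Frame

variable {ι : Type*} (F : L.Frame ι)

/-- The group `M' / M` for the lattice `M` spanned by a frame. -/
abbrev Grp : Type _ := ∀ i, ZMod (F.N i)

/-- The class of `x ∈ M'` in `M' / M` is `s`, where `M` is the lattice spanned by the frame. -/
def Rep (x : V) (s : F.Grp) : Prop :=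
  ∃ k : ι → ℤ, (∀ i, (k i : ℚ) = F.N i * F.v.repr x i) ∧ ∀ i, s i = k i

lemma rep_unique {x : V} {s t : F.Grp} (hs : F.Rep x s) (ht : F.Rep x t) : s = t := by
  obtain ⟨k, hk, hs⟩ := hs
  obtain ⟨m, hm, ht⟩ := ht
  funext i
  have : (k i : ℚ) = m i := by rw [hk, hm]
  rw [hs, ht, Int.cast_injective this]

lemma natCast_ne_zero (i : ι) : (F.N i : ℚ) ≠ 0 := Nat.cast_ne_zero.2 (NeZero.ne _)

variable {F} in
lemma Rep.add {x y : V} {s t : F.Grp} (hs : F.Rep x s) (ht : F.Rep y t) : F.Rep (x + y) (s + t) := by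
  obtain ⟨k, hk, hs⟩ := hs
  obtain ⟨m, hm, ht⟩ := ht
  refine ⟨k + m, fun i => ?_, fun i => ?_⟩
  · simp [hk, hm, mul_add]
  · simp [hs, ht]

variable {F} in
lemma Rep.neg {x : V} {s : F.Grp} (hs : F.Rep x s) : F.Rep (-x) (-s) := by
  obtain ⟨k, hk, hs⟩ := hs
  refine ⟨-k, fun i => ?_, fun i => ?_⟩
  · simp [hk]
  · simp [hs]

variable {F} in
lemma Rep.sub {x y : V} {s t : F.Grp} (hs : F.Rep x s) (ht : F.Rep y t) : F.Rep (x - y) (s - t) := by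
  rw [sub_eq_add_neg, sub_eq_add_neg]
  exact hs.add ht.neg

lemma rep_zero : F.Rep 0 0 := ⟨0, by simp, by simp⟩

variable [Fintype ι]

lemma form_eq (x y : V) : L.form x y =
    ∑ i, ((F.ε i : ℤ) : ℚ) * F.N i * F.v.repr x i * F.v.repr y i := by
  classical
  conv_lhs => rw [← F.v.sum_repr x, ← F.v.sum_repr y]
  simp only [map_sum, map_smul, LinearMap.sum_apply, LinearMap.smul_apply, smul_eq_mul]
  refine Finset.sum_congr rfl fun i _ => ?_
  rw [Finset.sum_eq_single i]
  · rw [F.self]; ring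
  · intro j _ hj
    rw [F.ortho j i hj]; ring
  · simp

lemma form_basis (x : V) (i : ι) : L.form x (F.v i) = ((F.ε i : ℤ) : ℚ) * F.N i * F.v.repr x i := by
  classical
  rw [F.form_eq, Finset.sum_eq_single i]
  · simp
  · intro j _ hj
    simp [hj.symm]
  · simp

lemma exists_rep {x : V} (hx : x ∈ L.dual) : ∃ s, F.Rep x s := by
  have : ∀ i, ∃ k : ℤ, (k : ℚ) = F.N i * F.v.repr x i := by
    intro i
    obtain ⟨k, hk⟩ := mem_dual.1 hx _ (F.mem i)
    rw [F.form_basis] at hk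
    -- Pairing with vᵢ gives εᵢ times the wanted integer, and εᵢ² = 1.
    refine ⟨F.ε i * k, ?_⟩
    have : (((F.ε i : ℤ) : ℚ)) * ((F.ε i : ℤ) : ℚ) = 1 := by
      rw [← Int.cast_mul, ← Units.val_mul, Int.units_mul_self]; simp
    push_cast
    linear_combination (((F.ε i : ℤ) : ℚ)) * hk + (F.N i * F.v.repr x i) * this
  choose k hk using this
  exact ⟨fun i => k i, k, hk, fun _ => rfl⟩

lemma exists_vec (s : F.Grp) : ∃ x, F.Rep x s := by
  choose k hk using fun i => ZMod.intCast_surjective (s i)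
  refine ⟨∑ i, ((k i : ℚ) / F.N i) • F.v i, k, fun i => ?_, fun i => (hk i).symm⟩
  rw [Module.Basis.repr_sum_self]
  have := F.natCast_ne_zero i
  field_simp

lemma mem_carrier_of_rep_zero {x : V} (hx : F.Rep x 0) : x ∈ L.carrier := by
  obtain ⟨k, hk, hs⟩ := hx
  rw [← F.v.sum_repr x]
  refine sum_mem fun i _ => ?_
  have h0 := (hs i).symm
  rw [Pi.zero_apply, ZMod.intCast_zmod_eq_zero_iff_dvd] at h0
  obtain ⟨m, hm⟩ := h0
  have : F.v.repr x i = m := by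
    have h := hk i
    rw [hm] at h
    push_cast at h
    exact (mul_left_cancel₀ (F.natCast_ne_zero i) h).symm
  rw [this, Int.cast_smul_eq_zsmul]
  exact L.carrier.smul_mem _ (F.mem i)

variable {F} in
lemma Rep.sub_mem {x y : V} {s : F.Grp} (hx : F.Rep x s) (hy : F.Rep y s) : x - y ∈ L.carrier := by
  have := hx.sub hy
  rw [sub_self] at this
  exact F.mem_carrier_of_rep_zero this

/-- The bilinear form on `M' / M`. -/
def bil (s t : F.Grp) : AddCircle (1 : ℚ) := ∑ i, (F.ε i : ℤ) • zmodBil (F.N i) (s i) (t i)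

/-- The quadratic form on `M' / M`. -/
def quad (s : F.Grp) : AddCircle (1 : ℚ) := ∑ i, (F.ε i : ℤ) • zmodQuad (F.N i) (s i)

lemma addCircle_coe_sum {κ : Type*} (S : Finset κ) (f : κ → ℚ) :
    ((∑ i ∈ S, f i : ℚ) : AddCircle (1 : ℚ)) = ∑ i ∈ S, (f i : AddCircle (1 : ℚ)) :=
  map_sum (QuotientAddGroup.mk' (AddSubgroup.zmultiples (1 : ℚ))) f S

variable {F} in
lemma Rep.bil {x y : V} {s t : F.Grp} (hx : F.Rep x s) (hy : F.Rep y t) :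
    F.bil s t = ((L.form x y : ℚ) : AddCircle (1 : ℚ)) := by
  obtain ⟨k, hk, hs⟩ := hx
  obtain ⟨m, hm, ht⟩ := hy
  rw [F.form_eq, addCircle_coe_sum, Frame.bil]
  refine Finset.sum_congr rfl fun i _ => ?_
  rw [hs, ht, zmodBil_intCast, ← AddCircle.coe_zsmul]
  congr 1
  have := F.natCast_ne_zero i
  rw [hk, hm, zsmul_eq_mul]
  field_simp

variable {F} in
lemma Rep.quad {x : V} {s : F.Grp} (hx : F.Rep x s) :
    F.quad s = ((L.form x x / 2 : ℚ) : AddCircle (1 : ℚ)) := by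
  obtain ⟨k, hk, hs⟩ := hx
  rw [F.form_eq, Finset.sum_div, addCircle_coe_sum, Frame.quad]
  refine Finset.sum_congr rfl fun i _ => ?_
  rw [hs, zmodQuad_intCast (F.even i), ← AddCircle.coe_zsmul]
  congr 1
  have := F.natCast_ne_zero i
  rw [hk, zsmul_eq_mul]
  field_simp

/-- The set of `s ∈ M' / M` lying over the coset `γ` of `L` in `L'`. -/
def Over (γ : L.Disc) (s : F.Grp) : Prop := ∃ x, F.Rep x s ∧ L.InCoset γ x

variable {F} in
lemma Rep.over_iff {x : V} {s : F.Grp} (hx : F.Rep x s) (γ : L.Disc) :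
    F.Over γ s ↔ L.InCoset γ x := by
  refine ⟨?_, fun h => ⟨x, hx, h⟩⟩
  rintro ⟨y, hy, h⟩
  exact h.congr (hx.sub_mem hy)

/-- The subgroup `L / M` of `M' / M`. -/
def sub : AddSubgroup F.Grp where
  carrier := {s | F.Over 0 s}
  add_mem' := by
    rintro s t ⟨x, hx, hx'⟩ ⟨y, hy, hy'⟩
    have := hx'.add hy'
    rw [add_zero] at this
    exact ⟨x + y, hx.add hy, this⟩
  zero_mem' := ⟨0, F.rep_zero, inCoset_zero (zero_mem _)⟩
  neg_mem' := by
    rintro s ⟨x, hx, hx'⟩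
    have h0 := (hx'.eq_iff (inCoset_zero (zero_mem _))).1 rfl
    rw [sub_zero] at h0
    exact ⟨-x, hx.neg, inCoset_zero (neg_mem h0)⟩

lemma mem_sub {s : F.Grp} : s ∈ F.sub ↔ ∃ x ∈ L.carrier, F.Rep x s := by
  constructor
  · rintro ⟨x, hx, hx'⟩
    have h0 := (hx'.eq_iff (inCoset_zero (zero_mem _))).1 rfl
    rw [sub_zero] at h0
    exact ⟨x, h0, hx⟩
  · rintro ⟨x, hx, h⟩
    exact ⟨x, h, inCoset_zero hx⟩

/-- The classes of M'/M above a given γ form one coset of L/M, so sums over a fibre become sums over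
a group. -/
lemma over_add_iff {γ : L.Disc} {s t : F.Grp} (hs : F.Over γ s) : F.Over γ (s + t) ↔ t ∈ F.sub := by
  obtain ⟨x, hx, hxγ⟩ := hs
  obtain ⟨y, hy⟩ := F.exists_vec t
  rw [(hx.add hy).over_iff]
  constructor
  · intro h
    have := (h.eq_iff hxγ).1 rfl
    rw [add_sub_cancel_left] at this
    exact (mem_sub F).2 ⟨y, this, hy⟩
  · intro h
    have := (hy.over_iff 0).1 h
    simpa using hxγ.add this

lemma exists_over (γ : L.Disc) : ∃ s, F.Over γ s := by
  obtain ⟨x, hx⟩ := exists_inCoset γ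
  obtain ⟨s, hs⟩ := F.exists_rep hx.1
  exact ⟨s, x, hs, hx⟩

lemma over_unique {γ δ : L.Disc} {s : F.Grp} (hγ : F.Over γ s) (hδ : F.Over δ s) : γ = δ := by
  obtain ⟨x, hx, hxγ⟩ := hγ
  rw [hx.over_iff] at hδ
  rw [hxγ.eq_iff hδ]
  simp

lemma bil_comm (s t : F.Grp) : F.bil s t = F.bil t s := by
  simp only [bil, zmodBil_comm]

lemma bil_add_right (s t u : F.Grp) : F.bil s (t + u) = F.bil s t + F.bil s u := by
  simp only [bil, Pi.add_apply, zmodBil_add_right, smul_add, Finset.sum_add_distrib]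

lemma bil_zero_right (s : F.Grp) : F.bil s 0 = 0 := by
  simpa using F.bil_add_right s 0 0

/-- The orthogonal complement of `L / M` is `L' / M`. -/
lemma exists_over_of_orthogonal {s : F.Grp} (h : ∀ t ∈ F.sub, F.bil s t = 0) : ∃ γ, F.Over γ s := by
  obtain ⟨x, hx⟩ := F.exists_vec s
  have hxd : x ∈ L.dual := by
    rw [mem_dual]
    intro y hy
    obtain ⟨t, ht⟩ := F.exists_rep (carrier_le_dual hy)
    have h0 := h t ((mem_sub F).2 ⟨y, hy, ht⟩)
    rw [hx.bil ht, AddCircle.coe_eq_zero_iff] at h0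
    obtain ⟨n, hn⟩ := h0
    exact ⟨n, by simpa using hn⟩
  exact ⟨_, x, hx, inCoset_mk hxd⟩

lemma bil_eq_zero_of_over {γ : L.Disc} {s t : F.Grp} (hs : F.Over γ s) (ht : t ∈ F.sub) :
    F.bil s t = 0 := by
  obtain ⟨x, hx, hxγ⟩ := hs
  obtain ⟨y, hy, hyt⟩ := (mem_sub F).1 ht
  rw [hx.bil hyt, AddCircle.coe_eq_zero_iff]
  obtain ⟨k, hk⟩ := mem_dual.1 hxγ.1 y hy
  exact ⟨k, by simpa using hk⟩

end Frame

end EvenLattice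

open scoped Classical in
section

namespace EvenLattice

variable {V : Type*} [AddCommGroup V] [Module ℚ V] {L : EvenLattice V}

namespace Frame

variable {ι : Type*} [Fintype ι] [DecidableEq ι] (F : L.Frame ι)

/-! ## Finite Fourier transforms -/

lemma expQZ_units_smul_injective (u : ℤˣ) (x : AddCircle (1 : ℚ)) :
    expQZ ((u : ℤ) • x) = 1 ↔ x = 0 := by
  rw [expQZ_eq_one_iff]
  rcases Int.units_eq_one_or u with rfl | rfl <;> simp

/-- The Fourier matrix of `M' / M`, or its complex conjugate. -/
def fourier (u : ℤˣ) : Matrix F.Grp F.Grp ℂ := fun s t => expQZ ((u : ℤ) • F.bil s t)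

/-- The Fourier matrix of `L' / L`, or its complex conjugate. -/
def _root_.EvenLattice.discFourier (L : EvenLattice V) (u : ℤˣ) : Matrix L.Disc L.Disc ℂ :=
  fun γ δ => expQZ ((u : ℤ) • L.bil γ δ)

/-- The matrix of the map `ℂ[M' / M] → ℂ[L' / L]` which sends the basis vector at `x + M` to the one
at `x + L` for `x ∈ L'`, and to zero for `x ∉ L'`. -/
def proj : Matrix L.Disc F.Grp ℂ := fun γ s => if F.Over γ s then 1 else 0

/-- The character `t ↦ 𝐞(± (s, t))` of a subgroup of `M' / M`. -/
def bilChar (u : ℤˣ) (s : F.Grp) (H : AddSubgroup F.Grp) : AddChar H ℂ where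
  toFun t := expQZ ((u : ℤ) • F.bil s t)
  map_zero_eq_one' := by simp [bil_zero_right]
  map_add_eq_mul' t t' := by
    rw [AddSubgroup.coe_add, bil_add_right, smul_add, expQZ_add]

/-- Orthogonality of characters: the pairing with s is the trivial character of H exactly when s is
orthogonal to H. -/
lemma sum_bilChar (u : ℤˣ) (s : F.Grp) (H : AddSubgroup F.Grp) :
    ∑ t : H, expQZ ((u : ℤ) • F.bil s t) =
      if ∀ t ∈ H, F.bil s t = 0 then (Nat.card H : ℂ) else 0 := by
  have h := AddChar.sum_eq_ite (F.bilChar u s H)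
  have h1 : F.bilChar u s H = 0 ↔ ∀ t ∈ H, F.bil s t = 0 := by
    constructor
    · intro h t ht
      have := congrArg (fun ψ => ψ ⟨t, ht⟩) h
      exact (expQZ_units_smul_injective u _).1 this
    · intro h
      ext t
      exact (expQZ_units_smul_injective u _).2 (h t t.2)
  rw [Nat.card_eq_fintype_card]
  simp only [h1] at h
  exact h

lemma sum_proj_mul {γ : L.Disc} {t₀ : F.Grp} (ht₀ : F.Over γ t₀) (f : F.Grp → ℂ) :
    ∑ t, F.proj γ t * f t = ∑ h : F.sub, f (t₀ + h) := by
  rw [← Equiv.sum_comp (Equiv.addLeft t₀)]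
  simp only [proj, Equiv.coe_addLeft, F.over_add_iff ht₀, ite_mul, one_mul, zero_mul]
  rw [← Finset.sum_filter]
  exact Finset.sum_subtype _ (by simp) _

lemma sum_disc_proj_mul {γ : L.Disc} {s : F.Grp} (hs : F.Over γ s) (f : L.Disc → ℂ) :
    ∑ μ, F.proj μ s * f μ = f γ := by
  rw [Finset.sum_eq_single γ]
  · simp [proj, hs]
  · intro μ _ hμ
    rw [proj, if_neg fun h => hμ (F.over_unique h hs), zero_mul]
  · simp

lemma sum_disc_proj_mul_of_not {s : F.Grp} (hs : ¬ ∃ γ, F.Over γ s) (f : L.Disc → ℂ) :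
    ∑ μ, F.proj μ s * f μ = 0 :=
  Finset.sum_eq_zero fun μ _ => by rw [proj, if_neg fun h => hs ⟨μ, h⟩, zero_mul]

/-- The index of `M` in `L`. -/
def index : ℕ := Nat.card F.sub

lemma index_ne_zero : (F.index : ℂ) ≠ 0 := by
  have : 0 < Nat.card F.sub := Nat.card_pos
  exact Nat.cast_ne_zero.2 this.ne'

lemma sum_proj (γ : L.Disc) : ∑ t, F.proj γ t = F.index := by
  obtain ⟨t₀, ht₀⟩ := F.exists_over γ
  have := F.sum_proj_mul ht₀ 1
  simpa [index, Nat.card_eq_fintype_card] using this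

/-- Distinct cosets of L have disjoint fibres in L'/M, each of size [L:M]. -/
lemma proj_mul_transpose : F.proj * F.projᵀ = (F.index : ℂ) • 1 := by
  ext γ δ
  obtain ⟨t₀, ht₀⟩ := F.exists_over γ
  rw [Matrix.mul_apply]
  simp only [Matrix.transpose_apply, Matrix.smul_apply, smul_eq_mul]
  by_cases h : γ = δ
  · subst h
    rw [Matrix.one_apply_eq, mul_one, ← F.sum_proj γ]
    refine Finset.sum_congr rfl fun t _ => ?_
    simp [proj]
  · rw [Matrix.one_apply_ne h, mul_zero]
    refine Finset.sum_eq_zero fun t _ => ?_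
    by_cases ht : F.Over γ t
    · have : ¬ F.Over δ t := fun h' => h (F.over_unique ht h')
      simp [proj, this]
    · simp [proj, ht]

/-- Summing the character of s over a coset of L/M gives zero unless s is orthogonal to L/M, that
is, unless s lies in L'/M. There the sum is [L:M] times the Fourier entry of L'/L. -/
lemma fourier_mul_transpose (u : ℤˣ) :
    F.fourier u * F.projᵀ = (F.index : ℂ) • (F.projᵀ * L.discFourier u) := by
  ext s γ
  obtain ⟨t₀, ht₀⟩ := F.exists_over γ
  simp only [Matrix.mul_apply, Matrix.smul_apply, smul_eq_mul, Matrix.transpose_apply]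
  have h1 : ∑ t, F.fourier u s t * F.proj γ t =
      expQZ ((u : ℤ) • F.bil s t₀) * ∑ h : F.sub, expQZ ((u : ℤ) • F.bil s h) := by
    simp only [mul_comm (F.fourier u s _)]
    rw [F.sum_proj_mul ht₀, Finset.mul_sum]
    refine Finset.sum_congr rfl fun h _ => ?_
    rw [fourier, bil_add_right, smul_add, expQZ_add]
  rw [h1, sum_bilChar]
  by_cases hs : ∃ μ, F.Over μ s
  · obtain ⟨μ, hμ⟩ := hs
    rw [if_pos fun t ht => F.bil_eq_zero_of_over hμ ht, F.sum_disc_proj_mul hμ, mul_comm, index]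
    congr 1
    obtain ⟨x, hx, hxμ⟩ := hμ
    obtain ⟨y, hy, hyγ⟩ := ht₀
    rw [discFourier, hx.bil hy, hxμ.bil hyγ]
  · rw [if_neg fun h => hs (F.exists_over_of_orthogonal h), F.sum_disc_proj_mul_of_not hs]
    simp

lemma fourier_transpose (u : ℤˣ) : (F.fourier u)ᵀ = F.fourier u := by
  ext s t
  rw [Matrix.transpose_apply, fourier, fourier, bil_comm]

lemma _root_.EvenLattice.bil_comm (γ δ : L.Disc) : L.bil γ δ = L.bil δ γ := by
  obtain ⟨x, hx⟩ := exists_inCoset γ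
  obtain ⟨y, hy⟩ := exists_inCoset δ
  have := L.symm.eq x y
  rw [hx.bil hy, hy.bil hx, this]

lemma discFourier_transpose (u : ℤˣ) : (L.discFourier u)ᵀ = L.discFourier u := by
  ext s t
  rw [Matrix.transpose_apply, discFourier, discFourier, EvenLattice.bil_comm]

lemma proj_mul_fourier (u : ℤˣ) :
    F.proj * F.fourier u = (F.index : ℂ) • (L.discFourier u * F.proj) := by
  have := congrArg Matrix.transpose (F.fourier_mul_transpose u)
  simpa [Matrix.transpose_mul, fourier_transpose, discFourier_transpose] using this

lemma eq_zero_of_bil_eq_zero {s : F.Grp} (h : ∀ t, F.bil s t = 0) : s = 0 := by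
  funext i
  have := h (Pi.single i 1)
  rw [bil, Finset.sum_eq_single i] at this
  · rw [Pi.single_eq_same] at this
    apply zmodBil_one_eq_zero
    rcases Int.units_eq_one_or (F.ε i) with h | h <;> simpa [h] using this
  · intro j _ hj
    have h0 : zmodBil (F.N j) (s j) 0 = 0 := by simpa using zmodBil_add_right 0 0 (s j)
    rw [Pi.single_eq_of_ne hj, h0, smul_zero]
  · simp

lemma sum_fourier (u : ℤˣ) (s : F.Grp) :
    ∑ t, F.fourier u s t = if s = 0 then (Fintype.card F.Grp : ℂ) else 0 := by
  have h := F.sum_bilChar u s ⊤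
  have h1 : (∀ t ∈ (⊤ : AddSubgroup F.Grp), F.bil s t = 0) ↔ s = 0 := by
    refine ⟨fun h => F.eq_zero_of_bil_eq_zero fun t => h t trivial, ?_⟩
    rintro rfl t -
    rw [bil_comm, bil_zero_right]
  rw [if_congr h1 rfl rfl] at h
  rw [AddSubgroup.card_top, Nat.card_eq_fintype_card] at h
  rw [← h]
  exact (Equiv.sum_comp AddSubgroup.topEquiv.toEquiv (fun t => F.fourier u s t)).symm

/-- Fourier inversion on M'/M, whose pairing is nondegenerate. -/
lemma fourier_mul_neg (u : ℤˣ) :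
    F.fourier u * F.fourier (-u) = (Fintype.card F.Grp : ℂ) • 1 := by
  ext s t
  rw [Matrix.mul_apply]
  have h1 : ∀ r, F.fourier u s r * F.fourier (-u) r t = F.fourier u (s - t) r := by
    intro r
    have h2 : F.bil (s - t) r = F.bil s r - F.bil r t := by
      have := F.bil_add_right r (s - t) t
      rw [sub_add_cancel] at this
      rw [F.bil_comm (s - t), F.bil_comm s, this, add_sub_cancel_right]
    rw [fourier, fourier, fourier, h2, ← expQZ_add, Units.val_neg, neg_zsmul, zsmul_sub, sub_eq_add_neg]
  simp only [h1, sum_fourier, sub_eq_zero, Matrix.smul_apply, Matrix.one_apply, smul_eq_mul,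
    mul_ite, mul_one, mul_zero]

/-- The Fourier matrix applied to the indicator of L/M is summed over M'/M in two ways. By inversion
only t = 0 contributes; by `fourier_mul_transpose` the result is [L:M] times the number of elements
of L'/M. -/
lemma card_eq : (Fintype.card F.Grp : ℂ) = (F.index : ℂ) ^ 2 * Nat.card L.Disc := by
  have h1 : ∑ s, ∑ t, F.fourier 1 s t * F.proj 0 t = Fintype.card F.Grp := by
    rw [Finset.sum_comm]
    have : ∀ t, ∑ s, F.fourier 1 s t * F.proj 0 t =
        (if t = 0 then (Fintype.card F.Grp : ℂ) else 0) * F.proj 0 t := by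
      intro t
      rw [← Finset.sum_mul, ← F.sum_fourier 1 t]
      congr 2
      funext s
      rw [fourier, fourier, bil_comm]
    simp only [this, ite_mul, zero_mul, Finset.sum_ite_eq', Finset.mem_univ, if_true]
    rw [proj, if_pos ⟨0, F.rep_zero, inCoset_zero (zero_mem _)⟩, mul_one]
  have h2 : ∀ s, ∑ t, F.fourier 1 s t * F.proj 0 t = F.index * ∑ μ, F.proj μ s := by
    intro s
    have := congrFun (congrFun (F.fourier_mul_transpose 1) s) 0
    simp only [Matrix.mul_apply, Matrix.smul_apply, smul_eq_mul, Matrix.transpose_apply] at this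
    rw [this]
    congr 1
    refine Finset.sum_congr rfl fun μ _ => ?_
    obtain ⟨x, hx⟩ := exists_inCoset μ
    rw [discFourier, hx.bil (inCoset_zero (zero_mem _))]
    simp
  rw [← h1]
  simp only [h2]
  rw [← Finset.mul_sum, Finset.sum_comm]
  simp only [sum_proj, Finset.sum_const, Finset.card_univ, nsmul_eq_mul, Nat.card_eq_fintype_card]
  ring

lemma sqrt_card_eq : ((Real.sqrt (Fintype.card F.Grp) : ℝ) : ℂ) =
    F.index * ((Real.sqrt (Nat.card L.Disc) : ℝ) : ℂ) := by
  have h : (Fintype.card F.Grp : ℝ) = (F.index : ℝ) ^ 2 * Nat.card L.Disc := by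
    exact_mod_cast F.card_eq
  rw [h, Real.sqrt_mul (by positivity), Real.sqrt_sq (by positivity)]
  push_cast; rfl

end Frame
end EvenLattice
end

open scoped Classical in
section

namespace EvenLattice

variable {V : Type*} [AddCommGroup V] [Module ℚ V] {L : EvenLattice V}

namespace Frame

variable {ι : Type*} [Fintype ι] [DecidableEq ι] (F : L.Frame ι)

/-! ## The Weil representation -/

/-- Complex conjugation at the positive vectors of the frame, the identity at the negative ones. -/
def twist (i : ι) : ℂ →+* ℂ := if F.ε i = 1 then starRingEnd ℂ else RingHom.id ℂ

/-- The twist is chosen so that in both signs a phase x becomes -εᵢx; this makes W a model of ρ⁻¹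
for an indefinite form. -/
lemma twist_expQZ (i : ι) (x : AddCircle (1 : ℚ)) :
    F.twist i (expQZ x) = expQZ (-((F.ε i : ℤ) • x)) := by
  rcases Int.units_eq_one_or (F.ε i) with h | h <;> simp [twist, h, star_expQZ]

lemma twist_ofReal (i : ι) (x : ℝ) : F.twist i (x : ℂ) = x := by
  rcases Int.units_eq_one_or (F.ε i) with h | h <;> simp [twist, h]

lemma exists_isTensorThetaMatrix (g : Mp2Z) :
    ∃ W, IsTensorThetaMatrix F.twist F.N F.N g W := by
  choose K hK using fun i => exists_isThetaMatrix (F.even i) g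
  exact ⟨_, K, hK, rfl⟩

/-- The action of `g ∈ Mp₂(ℤ)` on `ℂ[M' / M]`, an antihomomorphism in `g`. -/
def weil (g : Mp2Z) : Matrix F.Grp F.Grp ℂ := (F.exists_isTensorThetaMatrix g).choose

lemma isTensorThetaMatrix_weil (g : Mp2Z) : IsTensorThetaMatrix F.twist F.N F.N g (F.weil g) :=
  (F.exists_isTensorThetaMatrix g).choose_spec

lemma weil_mul (g h : Mp2Z) : F.weil (g * h) = F.weil h * F.weil g :=
  (F.isTensorThetaMatrix_weil (g * h)).unique
    ((F.isTensorThetaMatrix_weil g).mul (F.isTensorThetaMatrix_weil h))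

lemma weil_one : F.weil 1 = 1 :=
  (F.isTensorThetaMatrix_weil 1).unique IsTensorThetaMatrix.one

lemma weil_mul_weil_inv (g : Mp2Z) : F.weil g * F.weil g⁻¹ = 1 := by
  rw [← weil_mul, inv_mul_cancel, weil_one]

lemma weil_inv_mul_weil (g : Mp2Z) : F.weil g⁻¹ * F.weil g = 1 := by
  rw [← weil_mul, mul_inv_cancel, weil_one]

lemma weil_mpT : F.weil mpT = Matrix.diagonal fun s => expQZ (-F.quad s) := by
  refine (F.isTensorThetaMatrix_weil mpT).unique
    ⟨fun i => thetaMatrixT (F.N i), fun i => isThetaMatrix_T (F.even i), ?_⟩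
  have h : ∀ i, (thetaMatrixT (F.N i)).map (F.twist i) =
      Matrix.diagonal fun r => expQZ (-((F.ε i : ℤ) • zmodQuad (F.N i) r)) := by
    intro i
    rw [thetaMatrixT, Matrix.diagonal_map (map_zero _)]
    congr 1
    funext r
    exact F.twist_expQZ i _
  simp only [h]
  rw [piMatrix_diagonal]
  congr 1
  funext s
  rw [quad, ← Finset.sum_neg_distrib, expQZ_sum]

lemma weil_mpS_eq_sum : F.weil mpS =
    (expQZ ((((∑ i, (F.ε i : ℤ) : ℤ) : ℚ) / 8 : ℚ) : AddCircle (1 : ℚ)) /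
      (Real.sqrt (Fintype.card F.Grp) : ℂ)) • F.fourier 1 := by
  refine (F.isTensorThetaMatrix_weil mpS).unique
    ⟨fun i => thetaMatrixS (F.N i), fun i => isThetaMatrix_S (F.N i), ?_⟩
  ext s t
  have hcard : Real.sqrt (Fintype.card F.Grp) = ∏ i, Real.sqrt (F.N i) := by
    rw [Fintype.card_pi]
    simp only [ZMod.card, Nat.cast_prod]
    exact Real.sqrt_prod _ fun i _ => Nat.cast_nonneg _
  have h8 : ((((∑ i, (F.ε i : ℤ) : ℤ) : ℚ) / 8 : ℚ) : AddCircle (1 : ℚ)) =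
      ∑ i, -((F.ε i : ℤ) • ((-1 / 8 : ℚ) : AddCircle (1 : ℚ))) := by
    push_cast
    rw [Finset.sum_div, addCircle_coe_sum]
    refine Finset.sum_congr rfl fun i _ => ?_
    rw [← AddCircle.coe_zsmul, ← AddCircle.coe_neg]
    congr 1
    rw [zsmul_eq_mul]
    ring
  rw [Matrix.smul_apply, fourier, bil, hcard, h8, expQZ_sum, Units.val_one, one_zsmul, expQZ_sum,
    Complex.ofReal_prod, ← Finset.prod_div_distrib, smul_eq_mul, ← Finset.prod_mul_distrib, piMatrix]
  refine Finset.prod_congr rfl fun i _ => ?_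
  simp only [Matrix.map_apply, thetaMatrixS]
  rw [map_mul, map_div₀, twist_expQZ, twist_expQZ, twist_ofReal,
    zsmul_neg, neg_neg]

lemma equivalent_weightedSumSquares : QuadraticMap.Equivalent L.form.toQuadraticMap
    (QuadraticMap.weightedSumSquares ℚ fun i => ((F.ε i : ℤ) : ℚ) * F.N i) := by
  refine ⟨⟨F.v.equivFun, fun x => ?_⟩⟩
  rw [QuadraticMap.weightedSumSquares_apply, LinearMap.BilinMap.toQuadraticMap_apply, F.form_eq]
  refine Finset.sum_congr rfl fun i _ => ?_
  change _ * (F.v.repr x i * F.v.repr x i) = _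
  ring

/-- Sylvester's law of inertia for the diagonal form with entries εᵢNᵢ, all Nᵢ being positive. -/
lemma sgn_eq : L.sgn = ∑ i, (F.ε i : ℤ) := by
  have hpos : ∀ i, (0 : ℚ) < F.N i := fun i => Nat.cast_pos.2 (NeZero.pos _)
  rw [sgn, QuadraticForm.sigPos_of_equiv_weightedSumSquares F.equivalent_weightedSumSquares,
    QuadraticForm.sigNeg_of_equiv_weightedSumSquares F.equivalent_weightedSumSquares,
    Set.ncard_eq_toFinset_card', Set.ncard_eq_toFinset_card', Finset.card_eq_sum_ones,
    Finset.card_eq_sum_ones, Set.toFinset_ofPred, Set.toFinset_ofPred, Finset.sum_filter,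
    Finset.sum_filter]
  push_cast
  rw [← Finset.sum_sub_distrib]
  refine Finset.sum_congr rfl fun i _ => ?_
  have := hpos i
  rcases Int.units_eq_one_or (F.ε i) with h | h <;> simp [h, this, this.le]

lemma weil_mpS : F.weil mpS = (expQZ ((L.sgn / 8 : ℚ) : AddCircle (1 : ℚ)) /
    (Real.sqrt (Fintype.card F.Grp) : ℂ)) • F.fourier 1 := by
  rw [weil_mpS_eq_sum, F.sgn_eq]

/-- The matrix by which `S` acts in the Weil representation. -/
def _root_.EvenLattice.weilS (L : EvenLattice V) : Matrix L.Disc L.Disc ℂ :=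
  (expQZ ((-(L.sgn : ℚ) / 8 : ℚ) : AddCircle (1 : ℚ)) / (Real.sqrt (Nat.card L.Disc) : ℂ)) •
    L.discFourier (-1)

/-- The matrix by which `T` acts in the Weil representation. -/
def _root_.EvenLattice.weilT (L : EvenLattice V) : Matrix L.Disc L.Disc ℂ :=
  Matrix.diagonal fun γ => expQZ (L.q γ)

lemma sqrt_card_disc_ne_zero : ((Real.sqrt (Nat.card L.Disc) : ℝ) : ℂ) ≠ 0 := by
  have : 0 < Nat.card L.Disc := Nat.card_pos
  have h : 0 < Real.sqrt (Nat.card L.Disc) := Real.sqrt_pos.2 (Nat.cast_pos.2 this)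
  exact_mod_cast h.ne'

lemma sgn_factor_mul (L : EvenLattice V) : expQZ ((L.sgn / 8 : ℚ) : AddCircle (1 : ℚ)) *
    expQZ ((-(L.sgn : ℚ) / 8 : ℚ) : AddCircle (1 : ℚ)) = 1 := by
  rw [← expQZ_add, ← AddCircle.coe_add]
  have : ((L.sgn : ℚ) / 8 + -L.sgn / 8 : ℚ) = 0 := by ring
  rw [this]
  exact expQZ_zero

/-- The eighth roots of unity cancel, and |M'/M| = [L:M]²·|L'/L| makes the square roots collapse to
the index. -/
lemma weil_mpS_constant : expQZ ((L.sgn / 8 : ℚ) : AddCircle (1 : ℚ)) /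
    (Real.sqrt (Fintype.card F.Grp) : ℂ) *
    (expQZ ((-(L.sgn : ℚ) / 8 : ℚ) : AddCircle (1 : ℚ)) / (Real.sqrt (Nat.card L.Disc) : ℂ)) *
    (Fintype.card F.Grp : ℂ) = F.index := by
  have h := sqrt_card_disc_ne_zero (L := L)
  have hi := F.index_ne_zero
  have hsq : ((Real.sqrt (Nat.card L.Disc) : ℝ) : ℂ) * ((Real.sqrt (Nat.card L.Disc) : ℝ) : ℂ) =
      (Nat.card L.Disc : ℂ) := by
    rw [← Complex.ofReal_mul, Real.mul_self_sqrt (Nat.cast_nonneg _)]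
    push_cast; rfl
  rw [sqrt_card_eq, card_eq, ← hsq]
  have := sgn_factor_mul L
  generalize expQZ ((L.sgn / 8 : ℚ) : AddCircle (1 : ℚ)) = e at *
  generalize expQZ ((-(L.sgn : ℚ) / 8 : ℚ) : AddCircle (1 : ℚ)) = e' at *
  field_simp
  linear_combination this

lemma weil_mpS_mul_transpose_mul : F.weil mpS * F.projᵀ * L.weilS = F.projᵀ := by
  have h := F.fourier_mul_transpose (-1)
  have h2 : (F.index : ℂ) • (F.fourier 1 * F.projᵀ * L.discFourier (-1)) =
      (Fintype.card F.Grp : ℂ) • F.projᵀ := by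
    rw [Matrix.mul_assoc, ← Matrix.mul_smul, ← h, ← Matrix.mul_assoc, fourier_mul_neg,
      Matrix.smul_mul, Matrix.one_mul]
  rw [weil_mpS, weilS, Matrix.smul_mul, Matrix.smul_mul, Matrix.mul_smul, smul_smul]
  apply smul_right_injective _ F.index_ne_zero
  simp only
  rw [smul_comm, h2, smul_smul, weil_mpS_constant]

lemma weilS_mul_proj_mul_weil_mpS : L.weilS * (F.proj * F.weil mpS) = F.proj := by
  have h := F.proj_mul_fourier (-1)
  have h2 : (F.index : ℂ) • (L.discFourier (-1) * (F.proj * F.fourier 1)) =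
      (Fintype.card F.Grp : ℂ) • F.proj := by
    have h3 := F.fourier_mul_neg (-1)
    rw [neg_neg] at h3
    rw [← Matrix.mul_assoc, ← Matrix.smul_mul, ← h, Matrix.mul_assoc, h3,
      Matrix.mul_smul, Matrix.mul_one]
  rw [weil_mpS, weilS, Matrix.mul_smul, Matrix.smul_mul, Matrix.mul_smul, smul_smul]
  apply smul_right_injective _ F.index_ne_zero
  simp only
  rw [smul_comm, h2, smul_smul, mul_comm (expQZ _ / _), weil_mpS_constant]

lemma quad_eq_q {γ : L.Disc} {s : F.Grp} (h : F.Over γ s) : F.quad s = L.q γ := by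
  obtain ⟨x, hx, hxγ⟩ := h
  rw [hx.quad, hxγ.q]

lemma weil_mpT_mul_transpose_mul : F.weil mpT * F.projᵀ * L.weilT = F.projᵀ := by
  ext s γ
  rw [weil_mpT, weilT, Matrix.mul_diagonal, Matrix.diagonal_mul, Matrix.transpose_apply, proj]
  split_ifs with h
  · rw [F.quad_eq_q h, mul_one, ← expQZ_add, neg_add_cancel, expQZ_zero]
  · simp

lemma weilT_mul_proj_mul_weil_mpT : L.weilT * (F.proj * F.weil mpT) = F.proj := by
  ext γ s
  rw [weil_mpT, weilT, Matrix.diagonal_mul, Matrix.mul_diagonal, proj]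
  split_ifs with h
  · rw [F.quad_eq_q h, one_mul, ← expQZ_add, add_neg_cancel, expQZ_zero]
  · simp

/-- The inclusion `ℂ[L' / L] → ℂ[M' / M]` intertwines any representation with the prescribed values
at `S` and `T` with the action on `ℂ[M' / M]`. -/
lemma weil_mul_transpose (R : Mp2Z →* Matrix L.Disc L.Disc ℂ) (hT : R mpT = L.weilT)
    (hS : R mpS = L.weilS) (g : Mp2Z) : F.weil g * F.projᵀ * R g = F.projᵀ := by
  have hg : g ∈ Subgroup.closure {mpT, mpS} := by rw [closure_mpT_mpS]; trivial
  induction hg using Subgroup.closure_induction with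
  | mem x hx =>
    rcases hx with rfl | rfl
    · rw [hT, weil_mpT_mul_transpose_mul]
    · rw [hS, weil_mpS_mul_transpose_mul]
  | one => simp [weil_one]
  | mul x y _ _ hx hy =>
    rw [weil_mul, map_mul]
    calc F.weil y * F.weil x * F.projᵀ * (R x * R y)
        = F.weil y * (F.weil x * F.projᵀ * R x) * R y := by simp only [Matrix.mul_assoc]
      _ = F.projᵀ := by rw [hx, hy]
  | inv x _ hx =>
    have h1 : R x * R x⁻¹ = 1 := by rw [← map_mul, mul_inv_cancel, map_one]
    calc F.weil x⁻¹ * F.projᵀ * R x⁻¹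
        = F.weil x⁻¹ * (F.weil x * F.projᵀ * R x) * R x⁻¹ := by rw [hx]
      _ = (F.weil x⁻¹ * F.weil x) * F.projᵀ * (R x * R x⁻¹) := by simp only [Matrix.mul_assoc]
      _ = F.projᵀ := by rw [weil_inv_mul_weil, h1, Matrix.one_mul, Matrix.mul_one]

/-- The dual of `weil_mul_transpose`. Both are needed, since an element γαγ' has a factor of Mp₂(ℤ)
on each side of α. -/
lemma proj_mul_weil (R : Mp2Z →* Matrix L.Disc L.Disc ℂ) (hT : R mpT = L.weilT)
    (hS : R mpS = L.weilS) (g : Mp2Z) : R g * (F.proj * F.weil g) = F.proj := by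
  have hg : g ∈ Subgroup.closure {mpT, mpS} := by rw [closure_mpT_mpS]; trivial
  induction hg using Subgroup.closure_induction with
  | mem x hx =>
    rcases hx with rfl | rfl
    · rw [hT, weilT_mul_proj_mul_weil_mpT]
    · rw [hS, weilS_mul_proj_mul_weil_mpS]
  | one => simp [weil_one]
  | mul x y _ _ hx hy =>
    rw [weil_mul, map_mul]
    calc R x * R y * (F.proj * (F.weil y * F.weil x))
        = R x * ((R y * (F.proj * F.weil y)) * F.weil x) := by simp only [Matrix.mul_assoc]
      _ = F.proj := by rw [hy, hx]
  | inv x _ hx =>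
    have h1 : R x⁻¹ * R x = 1 := by rw [← map_mul, inv_mul_cancel, map_one]
    calc R x⁻¹ * (F.proj * F.weil x⁻¹)
        = R x⁻¹ * ((R x * (F.proj * F.weil x)) * F.weil x⁻¹) := by rw [hx]
      _ = (R x⁻¹ * R x) * F.proj * (F.weil x * F.weil x⁻¹) := by simp only [Matrix.mul_assoc]
      _ = F.proj := by rw [weil_mul_weil_inv, h1, Matrix.one_mul, Matrix.mul_one]

/-- The subspace `ℂ[L' / L]` of `ℂ[M' / M]` is stable. -/
lemma exists_weil_mul_transpose_eq (g : Mp2Z) :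
    ∃ D : Matrix L.Disc L.Disc ℂ, F.weil g * F.projᵀ = F.projᵀ * D := by
  -- A one-sided relation W Pᵀ D = Pᵀ suffices: it gives D a left inverse, which for square matrices
  -- is two-sided, so D can be moved across.
  have hinv : ∀ (g : Mp2Z) (D : Matrix L.Disc L.Disc ℂ), F.weil g * F.projᵀ * D = F.projᵀ →
      ∃ D' : Matrix L.Disc L.Disc ℂ, F.weil g * F.projᵀ = F.projᵀ * D' := by
    intro g D hD
    have h1 : ((F.index : ℂ)⁻¹ • (F.proj * F.weil g * F.projᵀ)) * D = 1 := by
      rw [Matrix.smul_mul, Matrix.mul_assoc F.proj, Matrix.mul_assoc F.proj, hD, proj_mul_transpose,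
        smul_smul, inv_mul_cancel₀ F.index_ne_zero, one_smul]
    refine ⟨(F.index : ℂ)⁻¹ • (F.proj * F.weil g * F.projᵀ), ?_⟩
    have h2 := mul_eq_one_comm.1 h1
    calc F.weil g * F.projᵀ
        = F.weil g * F.projᵀ * (D * ((F.index : ℂ)⁻¹ • (F.proj * F.weil g * F.projᵀ))) := by
          rw [h2, Matrix.mul_one]
      _ = _ := by rw [← Matrix.mul_assoc, hD]
  have hg : g ∈ Subgroup.closure {mpT, mpS} := by rw [closure_mpT_mpS]; trivial
  induction hg using Subgroup.closure_induction with
  | mem x hx =>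
    rcases hx with rfl | rfl
    · exact hinv _ _ F.weil_mpT_mul_transpose_mul
    · exact hinv _ _ F.weil_mpS_mul_transpose_mul
  | one => exact ⟨1, by simp [weil_one]⟩
  | mul x y _ _ hx hy =>
    obtain ⟨D, hD⟩ := hx
    obtain ⟨D', hD'⟩ := hy
    exact ⟨D' * D, by rw [weil_mul, Matrix.mul_assoc, hD, ← Matrix.mul_assoc, hD', Matrix.mul_assoc]⟩
  | inv x _ hx =>
    obtain ⟨D, hD⟩ := hx
    refine hinv _ D ?_
    rw [Matrix.mul_assoc, ← hD, ← Matrix.mul_assoc, weil_inv_mul_weil, Matrix.one_mul]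

/-- The Weil representation, as a matrix representation on `ℂ[L' / L]`. -/
def weilMatrix : Mp2Z →* Matrix L.Disc L.Disc ℂ where
  toFun g := (F.index : ℂ)⁻¹ • (F.proj * F.weil g⁻¹ * F.projᵀ)
  map_one' := by
    rw [inv_one, weil_one, Matrix.mul_one, proj_mul_transpose, smul_smul,
      inv_mul_cancel₀ F.index_ne_zero, one_smul]
  map_mul' g h := by
    obtain ⟨D, hD⟩ := F.exists_weil_mul_transpose_eq h⁻¹
    have hD' : (F.index : ℂ)⁻¹ • (F.proj * F.weil h⁻¹ * F.projᵀ) = D := by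
      rw [Matrix.mul_assoc, hD, ← Matrix.mul_assoc, proj_mul_transpose, Matrix.smul_mul,
        smul_smul, inv_mul_cancel₀ F.index_ne_zero, one_smul, Matrix.one_mul]
    rw [hD', _root_.mul_inv_rev, weil_mul, Matrix.smul_mul, Matrix.mul_assoc, Matrix.mul_assoc, hD]
    simp only [Matrix.mul_assoc]

/-- Reads the values of ρ at S and T off the intertwining relations already checked there. -/
lemma weilMatrix_eq {g : Mp2Z} {D : Matrix L.Disc L.Disc ℂ}
    (h : F.weil g * F.projᵀ * D = F.projᵀ) : F.weilMatrix g = D := by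
  change (F.index : ℂ)⁻¹ • (F.proj * F.weil g⁻¹ * F.projᵀ) = D
  conv_lhs => rw [← h]
  have h1 : F.proj * F.weil g⁻¹ * (F.weil g * F.projᵀ * D) = (F.index : ℂ) • D := by
    calc _ = F.proj * (F.weil g⁻¹ * F.weil g) * F.projᵀ * D := by simp only [Matrix.mul_assoc]
      _ = _ := by rw [weil_inv_mul_weil, Matrix.mul_one, proj_mul_transpose, Matrix.smul_mul,
        Matrix.one_mul]
  rw [h1, smul_smul, inv_mul_cancel₀ F.index_ne_zero, one_smul]

end Frame

/-- The matrix of an endomorphism of `ℂ[L' / L]` in the standard basis. -/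
def toMat (L : EvenLattice V) : (L.GroupSpace →ₗ[ℂ] L.GroupSpace) ≃ₐ[ℂ] Matrix L.Disc L.Disc ℂ :=
  LinearMap.toMatrixAlgEquiv (Finsupp.basisSingleOne (R := ℂ) (ι := L.Disc))

lemma toMat_apply (f : L.GroupSpace →ₗ[ℂ] L.GroupSpace) (μ γ : L.Disc) :
    L.toMat f μ γ = f (L.basisVec γ) μ := by
  simp [toMat, LinearMap.toMatrixAlgEquiv_apply, basisVec]

lemma isWeilRep_iff (ρ : Representation ℂ Mp2Z L.GroupSpace) :
    L.IsWeilRep ρ ↔ L.toMat (ρ mpT) = L.weilT ∧ L.toMat (ρ mpS) = L.weilS := by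
  refine and_congr ?_ ?_
  · rw [← Matrix.ext_iff, forall_comm]
    refine forall_congr' fun γ => ?_
    rw [Finsupp.ext_iff]
    refine forall_congr' fun μ => ?_
    rw [toMat_apply, weilT, Matrix.diagonal_apply]
    simp only [basisVec, Finsupp.smul_single, smul_eq_mul, mul_one, Finsupp.single_apply]
    by_cases h : μ = γ
    · simp [h]
    · simp [h, Ne.symm h]
  · rw [← Matrix.ext_iff, forall_comm]
    refine forall_congr' fun γ => ?_
    rw [Finsupp.ext_iff]
    refine forall_congr' fun μ => ?_
    rw [toMat_apply]
    have : ((expQZ ((-(L.sgn : ℚ) / 8 : ℚ) : AddCircle (1 : ℚ)) /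
        (Real.sqrt (Nat.card L.Disc) : ℂ)) •
        ∑ μ : L.Disc, expQZ (-(L.bil γ μ)) • L.basisVec μ) μ = L.weilS μ γ := by
      rw [Finsupp.smul_apply, Finsupp.finsetSum_apply, Finset.sum_eq_single μ]
      · simp [basisVec, weilS, discFourier, EvenLattice.bil_comm γ μ]
      · intro δ _ hδ
        simp [basisVec, hδ]
      · simp
    rw [this]

lemma exists_isWeilRep {ι : Type*} [Fintype ι] [DecidableEq ι] (F : L.Frame ι) :
    ∃ ρ, L.IsWeilRep ρ := by
  refine ⟨L.toMat.symm.toAlgHom.toRingHom.toMonoidHom.comp F.weilMatrix, ?_⟩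
  rw [isWeilRep_iff]
  constructor
  · exact (L.toMat.apply_symm_apply _).trans (F.weilMatrix_eq F.weil_mpT_mul_transpose_mul)
  · exact (L.toMat.apply_symm_apply _).trans (F.weilMatrix_eq F.weil_mpS_mul_transpose_mul)

lemma isWeilRep_weilRep {ι : Type*} [Fintype ι] [DecidableEq ι] (F : L.Frame ι) :
    L.IsWeilRep L.weilRep := by
  have h := exists_isWeilRep F
  rw [weilRep, dif_pos h]
  exact h.choose_spec

end EvenLattice
end

open scoped Classical in
section

namespace EvenLattice

variable {V : Type*} [AddCommGroup V] [Module ℚ V]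

/-! ## Existence of frames, and operations on them -/

lemma exists_zsmul_mem (L : EvenLattice V) (x : V) : ∃ n : ℤ, n ≠ 0 ∧ n • x ∈ L.carrier := by
  have := L.lattice
  have hx : x ∈ Submodule.span ℚ (L.carrier : Set V) := by
    rw [Submodule.IsLattice.span_eq_top]; trivial
  induction hx using Submodule.span_induction with
  | mem x hx => exact ⟨1, one_ne_zero, by simpa using hx⟩
  | zero => exact ⟨1, one_ne_zero, by simp⟩
  | add x y _ _ hx hy =>
    obtain ⟨n, hn, hnx⟩ := hx
    obtain ⟨m, hm, hmy⟩ := hy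
    refine ⟨m * n, mul_ne_zero hm hn, ?_⟩
    rw [smul_add, mul_smul, mul_comm, mul_smul]
    exact add_mem (L.carrier.smul_mem _ hnx) (L.carrier.smul_mem _ hmy)
  | smul c x _ hx =>
    obtain ⟨n, hn, hnx⟩ := hx
    refine ⟨c.den * n, mul_ne_zero (by exact_mod_cast c.den_ne_zero) hn, ?_⟩
    have h : ((c.den * n : ℤ) • (c • x) : V) = c.num • (n • x) := by
      rw [← Int.cast_smul_eq_zsmul ℚ, ← Int.cast_smul_eq_zsmul ℚ c.num,
        ← Int.cast_smul_eq_zsmul ℚ n, smul_smul, smul_smul]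
      congr 1
      push_cast
      rw [mul_right_comm, mul_comm (c.den : ℚ) c, Rat.mul_den_eq_num]
    rw [h]
    exact L.carrier.smul_mem _ hnx

lemma finiteDimensional (L : EvenLattice V) : FiniteDimensional ℚ V := by
  have := L.lattice
  exact Module.Finite.of_basis ((Module.Free.chooseBasis ℤ L.carrier).extendOfIsLattice ℚ)

lemma dim_eq_finrank (L : EvenLattice V) : L.dim = Module.finrank ℚ V := by
  have := L.lattice
  exact congrArg Cardinal.toNat (Submodule.IsLattice.rank' ℚ L.carrier)

/-- Diagonalize the form over ℚ and clear denominators. Evenness of L makes each Nᵢ even, as theta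
functions of level Nᵢ require for T. -/
lemma nonempty_frame (L : EvenLattice V) : Nonempty (L.Frame (Fin (Module.finrank ℚ V))) := by
  have := L.finiteDimensional
  obtain ⟨w, hw⟩ := LinearMap.BilinForm.exists_orthogonal_basis
    (B := L.form) ⟨fun x y => L.symm.eq x y⟩
  choose n hn hmem using fun i => L.exists_zsmul_mem (w i)
  have hu : ∀ i, IsUnit ((n i : ℤ) : ℚ) := fun i => isUnit_iff_ne_zero.2 (by exact_mod_cast hn i)
  have hv : ∀ i, w.isUnitSMul hu i = n i • w i := fun i => by
    rw [Module.Basis.isUnitSMul_apply, Int.cast_smul_eq_zsmul]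
  have hortho : ∀ i j, i ≠ j → L.form (w.isUnitSMul hu i) (w.isUnitSMul hu j) = 0 := by
    intro i j hij
    have h0 : L.form (w i) (w j) = 0 := hw hij
    rw [hv, hv, map_zsmul, map_zsmul, LinearMap.smul_apply, h0]
    simp
  choose k hk using fun i => L.even _ (by rw [hv]; exact hmem i : w.isUnitSMul hu i ∈ L.carrier)
  -- A basis vector of norm zero would be orthogonal to the whole basis, against nondegeneracy.
  have hk0 : ∀ i, k i ≠ 0 := by
    intro i h0
    have hself := hk i
    rw [h0, Int.cast_zero, mul_zero] at hself
    have : L.form (w.isUnitSMul hu i) = 0 := by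
      refine (w.isUnitSMul hu).ext fun j => ?_
      by_cases hij : i = j
      · subst hij; rw [hself]; rfl
      · rw [hortho i j hij]; rfl
    have hz := L.nondeg.1 (w.isUnitSMul hu i) fun y => by rw [this]; rfl
    exact (w.isUnitSMul hu).ne_zero i hz
  exact ⟨{
    v := w.isUnitSMul hu
    N := fun i => (2 * k i).natAbs
    ε := fun i => if 0 < k i then 1 else -1
    pos := fun i => ⟨Int.natAbs_ne_zero.2 (mul_ne_zero two_ne_zero (hk0 i))⟩
    even := fun i => by rw [Int.natAbs_mul]; exact even_two_mul _
    ortho := hortho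
    self := fun i => by
      have habs : (((2 * k i).natAbs : ℕ) : ℚ) = ((|2 * k i| : ℤ) : ℚ) := by
        rw [← Int.natCast_natAbs]; simp
      rw [hk, habs]
      split_ifs with h
      · rw [abs_of_pos (by linarith)]; push_cast; ring
      · rw [abs_of_nonpos (by linarith)]; push_cast; ring
    mem := fun i => by rw [hv]; exact hmem i }⟩

variable {L : EvenLattice V}

namespace Frame

variable {ι : Type*} (F : L.Frame ι)

/-- The frame `(m vᵢ)`. -/
def scale (m : ℕ) [NeZero m] : L.Frame ι where
  v := F.v.isUnitSMul fun _ => isUnit_iff_ne_zero.2 (Nat.cast_ne_zero.2 (NeZero.ne m) : (m : ℚ) ≠ 0)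
  N i := F.N i * m ^ 2
  ε := F.ε
  pos i := ⟨mul_ne_zero (NeZero.ne _) (pow_ne_zero _ (NeZero.ne m))⟩
  even i := (F.even i).mul_right _
  ortho i j hij := by
    simp [Module.Basis.isUnitSMul_apply, F.ortho i j hij]
  self i := by
    simp only [Module.Basis.isUnitSMul_apply, map_smul, LinearMap.smul_apply, F.self, smul_eq_mul]
    push_cast
    ring
  mem i := by
    rw [Module.Basis.isUnitSMul_apply, Nat.cast_smul_eq_nsmul]
    exact L.carrier.smul_of_tower_mem m (F.mem i)

/-- The frame `(vᵢ)`, considered as a frame in `L(r)`. -/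
def rescale (r : ℕ) [NeZero r] : (L.rescale r).Frame ι where
  v := F.v
  N i := F.N i * r
  ε := F.ε
  pos i := ⟨mul_ne_zero (NeZero.ne _) (NeZero.ne r)⟩
  even i := (F.even i).mul_right _
  ortho i j hij := by
    simp [EvenLattice.rescale, F.ortho i j hij]
  self i := by
    simp only [EvenLattice.rescale, LinearMap.smul_apply, F.self, smul_eq_mul]
    push_cast
    ring
  mem i := F.mem i

variable [Fintype ι]

lemma rep_zero_iff (x : V) : F.Rep x 0 ↔ ∀ i, ∃ m : ℤ, F.v.repr x i = m := by
  constructor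
  · rintro ⟨k, hk, hs⟩ i
    have h0 := (hs i).symm
    rw [Pi.zero_apply, ZMod.intCast_zmod_eq_zero_iff_dvd] at h0
    obtain ⟨m, hm⟩ := h0
    refine ⟨m, ?_⟩
    have h := hk i
    rw [hm] at h
    push_cast at h
    exact (mul_left_cancel₀ (F.natCast_ne_zero i) h).symm
  · intro h
    choose m hm using h
    exact ⟨fun i => F.N i * m i, fun i => by rw [hm]; push_cast; rfl, fun i => by simp⟩

/-- Both numbers count L/M. The ambient groups differ, but a vector represents zero in either one
exactly when its coordinates are integers. -/
lemma index_rescale [DecidableEq ι] (r : ℕ) [NeZero r] : (F.rescale r).index = F.index := by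
  have hx : ∀ s : F.sub, ∃ x ∈ L.carrier, F.Rep x s := fun s => (mem_sub F).1 s.2
  choose x hxL hxs using hx
  choose t ht using fun s => (F.rescale r).exists_rep
    (carrier_le_dual (show x s ∈ (L.rescale r).carrier from hxL s))
  have hmem : ∀ s, t s ∈ (F.rescale r).sub := fun s => (mem_sub _).2 ⟨x s, hxL s, ht s⟩
  symm
  refine Nat.card_eq_of_bijective (fun s => (⟨t s, hmem s⟩ : (F.rescale r).sub)) ⟨?_, ?_⟩
  · intro s s' hss
    have h1 : t s = t s' := congrArg Subtype.val hss
    have h2 := (ht s).sub (ht s')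
    rw [h1, sub_self] at h2
    have h3 : F.Rep (x s - x s') 0 := (F.rep_zero_iff _).2 (((F.rescale r).rep_zero_iff _).1 h2)
    have h4 := F.rep_unique h3 ((hxs s).sub (hxs s'))
    exact Subtype.ext (sub_eq_zero.1 h4.symm)
  · rintro ⟨u, hu⟩
    obtain ⟨y, hyL, hy⟩ := (mem_sub _).1 hu
    obtain ⟨s, hs⟩ := F.exists_rep (carrier_le_dual (show y ∈ L.carrier from hyL))
    refine ⟨⟨s, (mem_sub F).2 ⟨y, hyL, hs⟩⟩, Subtype.ext ?_⟩
    have h2 := (hxs ⟨s, (mem_sub F).2 ⟨y, hyL, hs⟩⟩).sub hs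
    rw [sub_self] at h2
    have h3 := ((F.rescale r).rep_zero_iff _).2 ((F.rep_zero_iff _).1 h2)
    have h4 := (F.rescale r).rep_unique h3 ((ht ⟨s, (mem_sub F).2 ⟨y, hyL, hs⟩⟩).sub hy)
    exact sub_eq_zero.1 h4.symm

variable [DecidableEq ι]

/-- The action of `((u b; 0 w), c)`, `u w = m²`, from `ℂ[M' / M]` to `ℂ[(m M)' / m M]`. -/
def tri (m : ℕ) [NeZero m] (u w : ℕ) [NeZero w] (b : ℤ) (c : ℝ) : Matrix (F.scale m).Grp F.Grp ℂ :=
  piMatrix fun i => (thetaMatrixTri (F.N i) (F.N i * m ^ 2) u w b c).map (F.twist i)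

lemma isTensorThetaMatrix_tri (m : ℕ) [NeZero m] {u w : ℕ} [NeZero u] [NeZero w] (h : u * w = m ^ 2)
    (b : ℤ) (c : ℝ) (hxz : (0 : ℚ) < u * w) (hc : c ^ 2 = (w : ℚ)) :
    IsTensorThetaMatrix F.twist F.N (F.scale m).N (MpGL.triangular u b w c hxz hc)
      (F.tri m u w b c) :=
  ⟨_, fun i => isThetaMatrix_tri (F.even i) (by rw [h]; rfl) b c hxz hc, rfl⟩

/-- The class of `w y` for `y` in the class `r`. -/
def rescaleDown (w : ℕ) [NeZero w] (r : (F.rescale w).Grp) : F.Grp := fun i =>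
  (ZMod.cast (r i : ZMod (F.N i * w)) : ZMod (F.N i))

/-- The class of `m y` for `y` in the class `r`. -/
def rescaleUp (m : ℕ) [NeZero m] (u w : ℕ) [NeZero w] (r : (F.rescale w).Grp) : (F.scale m).Grp :=
  fun i => ((u * ZMod.val (r i : ZMod (F.N i * w)) : ℕ) : ZMod (F.N i * m ^ 2))

lemma rep_rescaleDown {w : ℕ} [NeZero w] {r : (F.rescale w).Grp} {y : V}
    (hy : (F.rescale w).Rep y r) : F.Rep (w • y) (F.rescaleDown w r) := by
  obtain ⟨k, hk, hr⟩ := hy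
  refine ⟨k, fun i => ?_, fun i => ?_⟩
  · have h : (k i : ℚ) = ((F.N i * w : ℕ) : ℚ) * F.v.repr y i := hk i
    rw [h]
    simp only [map_nsmul, Finsupp.smul_apply, nsmul_eq_mul]
    push_cast
    ring
  · have h : r i = ((k i : ℤ) : ZMod (F.N i * w)) := hr i
    rw [rescaleDown, h]
    exact ZMod.cast_intCast (dvd_mul_right _ _) _

lemma _root_.natCast_mul_val_intCast {N M u w : ℕ} [NeZero (N * w)] (hM : M = N * (u * w)) (k : ℤ) :
    ((u * ZMod.val (k : ZMod (N * w)) : ℕ) : ZMod M) = ((u * k : ℤ) : ZMod M) := by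
  rw [← Int.cast_natCast, ZMod.intCast_eq_intCast_iff_dvd_sub]
  refine ⟨k / (N * w : ℕ), ?_⟩
  rw [Nat.cast_mul, ZMod.val_intCast, Int.emod_def, hM]
  push_cast
  ring

/-- In the basis m vᵢ of norm Nᵢm² = Nᵢuw, the coordinate kᵢ/(Nᵢw) of y becomes the same coordinate
of my, whose class is therefore ukᵢ. -/
lemma rep_rescaleUp {m : ℕ} [NeZero m] {u w : ℕ} [NeZero u] [NeZero w] (huw : u * w = m ^ 2)
    {r : (F.rescale w).Grp} {y : V} (hy : (F.rescale w).Rep y r) :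
    (F.scale m).Rep (m • y) (F.rescaleUp m u w r) := by
  obtain ⟨k, hk, hr⟩ := hy
  have hm0 : (m : ℚ) ≠ 0 := Nat.cast_ne_zero.2 (NeZero.ne m)
  refine ⟨fun i => u * k i, fun i => ?_, fun i => ?_⟩
  · have h : (k i : ℚ) = ((F.N i * w : ℕ) : ℚ) * F.v.repr y i := hk i
    have h2 : (F.scale m).v.repr (m • y) i = F.v.repr y i := by
      simp only [map_nsmul, Finsupp.smul_apply, nsmul_eq_mul]
      rw [scale, Module.Basis.repr_isUnitSMul]
      simp [Units.smul_def, hm0]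
    have h3 : (F.scale m).N i = F.N i * (u * w) := by rw [huw]; rfl
    rw [h2, h3]
    push_cast
    rw [h]
    push_cast
    ring
  · have h : r i = ((k i : ℤ) : ZMod (F.N i * w)) := hr i
    have h0 : NeZero (F.N i * w) := (F.rescale w).pos i
    change ((u * ZMod.val (r i : ZMod (F.N i * w)) : ℕ) : ZMod (F.N i * m ^ 2)) =
      ((u * k i : ℤ) : ZMod (F.N i * m ^ 2))
    rw [h]
    exact natCast_mul_val_intCast (by rw [huw]) (k i)

/-- The summation indices r mod Nᵢw of the factors combine to a class y in M(w)'/M. The action sends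
the class of wy to that of my with phase -b q_w(y). -/
lemma tri_apply (m : ℕ) [NeZero m] (u w : ℕ) [NeZero w] (b : ℤ) (c : ℝ) (s : (F.scale m).Grp)
    (j : F.Grp) : F.tri m u w b c s j = ∑ r : (F.rescale w).Grp,
      if F.rescaleDown w r = j ∧ F.rescaleUp m u w r = s then
        (c : ℂ)⁻¹ ^ Fintype.card ι * expQZ (-(b • (F.rescale w).quad r)) else 0 := by
  have h1 : F.tri m u w b c s j = ∏ i, ∑ r : ZMod (F.N i * w),
      if (r.cast : ZMod (F.N i)) = j i ∧ ((u * r.val : ℕ) : ZMod (F.N i * m ^ 2)) = s i then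
      (c : ℂ)⁻¹ * expQZ (-((F.ε i : ℤ) • b • zmodQuad (F.N i * w) r)) else 0 := by
    change ∏ i, (thetaMatrixTri (F.N i) (F.N i * m ^ 2) u w b c).map (F.twist i) (s i) (j i) = _
    refine Finset.prod_congr rfl fun i _ => ?_
    change F.twist i (∑ r : ZMod (F.N i * w), _) = _
    rw [map_sum]
    refine Finset.sum_congr rfl fun r _ => ?_
    rw [apply_ite (F.twist i), map_mul, map_zero, twist_expQZ, ← Complex.ofReal_inv, twist_ofReal]
    congr
  rw [h1, Finset.prod_univ_sum, Fintype.piFinset_univ]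
  refine Finset.sum_congr rfl fun r _ => ?_
  by_cases h : F.rescaleDown w r = j ∧ F.rescaleUp m u w r = s
  · rw [if_pos h]
    obtain ⟨rfl, rfl⟩ := h
    have h2 : ∀ i, (if ((r i).cast : ZMod (F.N i)) = F.rescaleDown w r i ∧
        ((u * (r i).val : ℕ) : ZMod (F.N i * m ^ 2)) = F.rescaleUp m u w r i then
        (c : ℂ)⁻¹ * expQZ (-((F.ε i : ℤ) • b • zmodQuad (F.N i * w) (r i))) else 0) =
        (c : ℂ)⁻¹ * expQZ (-((F.ε i : ℤ) • b • zmodQuad (F.N i * w) (r i))) :=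
      fun i => if_pos ⟨rfl, rfl⟩
    rw [Finset.prod_congr rfl fun i _ => h2 i, Finset.prod_mul_distrib, Finset.prod_const,
      Finset.card_univ, ← expQZ_sum]
    congr 2
    change _ = -(b • ∑ i, (F.ε i : ℤ) • zmodQuad (F.N i * w) (r i))
    rw [Finset.smul_sum, ← Finset.sum_neg_distrib]
    refine Finset.sum_congr rfl fun i _ => ?_
    rw [smul_comm b]
  · rw [if_neg h]
    have : ∃ i, ¬ (((r i).cast : ZMod (F.N i)) = j i ∧
        ((u * (r i).val : ℕ) : ZMod (F.N i * m ^ 2)) = s i) := by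
      by_contra hcon
      push Not at hcon
      exact h ⟨funext fun i => (hcon i).1, funext fun i => (hcon i).2⟩
    obtain ⟨i, hi⟩ := this
    exact Finset.prod_eq_zero (Finset.mem_univ i) (if_neg hi)

end Frame

lemma form_rescale (r : ℕ) [NeZero r] (x y : V) : (L.rescale r).form x y = r * L.form x y := rfl

lemma InCoset.incl {γ : L.Disc} {x : V} (hx : L.InCoset γ x) (r : ℕ) [NeZero r] :
    (L.rescale r).InCoset (L.incl r γ) x := by
  obtain ⟨hx, rfl⟩ := hx
  exact ⟨L.dual_le_rescale r hx, rfl⟩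

/-- Turns a condition between different discriminant groups into one on a single vector y, which
allows comparison with classes in M(w)'/M. -/
lemma nsmul_eq_incl_iff {r : ℕ} [NeZero r] {δ : (L.rescale r).Disc} {y : V}
    (hy : (L.rescale r).InCoset δ y) (n : ℕ) (γ : L.Disc) :
    n • δ = L.incl r γ ↔ L.InCoset γ (n • y) := by
  obtain ⟨x, hx⟩ := exists_inCoset γ
  rw [(hy.nsmul n).eq_iff (hx.incl r)]
  refine ⟨fun h => hx.congr h, fun h => (h.eq_iff hx).1 rfl⟩

lemma mem_dual_rescale_iff {r : ℕ} [NeZero r] {y : V} :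
    y ∈ (L.rescale r).dual ↔ r • y ∈ L.dual := by
  rw [mem_dual, mem_dual]
  refine forall₂_congr fun z _ => exists_congr fun k => ?_
  rw [form_rescale, map_nsmul, LinearMap.smul_apply, nsmul_eq_mul]

lemma incl_injective (r : ℕ) [NeZero r] : Function.Injective (L.incl r) := by
  intro γ δ h
  obtain ⟨x, hx⟩ := exists_inCoset γ
  obtain ⟨y, hy⟩ := exists_inCoset δ
  rw [hx.eq_iff hy]
  exact ((hx.incl r).eq_iff (hy.incl r)).1 h

namespace Frame

variable {ι : Type*} [Fintype ι] [DecidableEq ι] (F : L.Frame ι)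

/-- The matrix entries of the action of `((u b; 0 w), c)` on `ℂ[L' / L]`. -/
lemma proj_mul_tri_mul_transpose (m : ℕ) [NeZero m] {u w : ℕ} [NeZero u] [NeZero w]
    (huw : u * w = m ^ 2) (b : ℤ) (c : ℝ) (μ γ : L.Disc) :
    ((F.scale m).proj * F.tri m u w b c * F.projᵀ) μ γ = F.index * ((c : ℂ)⁻¹ ^ Fintype.card ι *
      ∑ δ : (L.rescale w).Disc, if w • δ = L.incl w γ ∧ m • δ = L.incl w μ then
        expQZ (-(b • (L.rescale w).q δ)) else 0) := by
  have h1 : ((F.scale m).proj * F.tri m u w b c * F.projᵀ) μ γ =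
      ∑ r : (F.rescale w).Grp, (F.scale m).proj μ (F.rescaleUp m u w r) *
        F.proj γ (F.rescaleDown w r) *
        ((c : ℂ)⁻¹ ^ Fintype.card ι * expQZ (-(b • (F.rescale w).quad r))) := by
    simp only [Matrix.mul_apply, Matrix.transpose_apply, tri_apply, Finset.mul_sum, Finset.sum_mul]
    rw [Finset.sum_comm]
    have : ∀ s : (F.scale m).Grp, ∑ j : F.Grp, ∑ r : (F.rescale w).Grp,
        (F.scale m).proj μ s * (if F.rescaleDown w r = j ∧ F.rescaleUp m u w r = s then
          (c : ℂ)⁻¹ ^ Fintype.card ι * expQZ (-(b • (F.rescale w).quad r)) else 0) * F.proj γ j =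
        ∑ r : (F.rescale w).Grp, if F.rescaleUp m u w r = s then
          (F.scale m).proj μ (F.rescaleUp m u w r) * F.proj γ (F.rescaleDown w r) *
          ((c : ℂ)⁻¹ ^ Fintype.card ι * expQZ (-(b • (F.rescale w).quad r))) else 0 := by
      intro s
      rw [Finset.sum_comm]
      refine Finset.sum_congr rfl fun r _ => ?_
      rw [Finset.sum_eq_single (F.rescaleDown w r)]
      · by_cases h : F.rescaleUp m u w r = s
        · subst h; simp only [and_self, if_true]; ring
        · simp [h]
      · intro j _ hj
        rw [if_neg fun h => hj h.1.symm, mul_zero, zero_mul]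
      · simp
    rw [Finset.sum_congr rfl fun s _ => this s, Finset.sum_comm]
    refine Finset.sum_congr rfl fun r _ => ?_
    rw [Finset.sum_ite_eq, if_pos (Finset.mem_univ _)]
  -- Each δ is spread over its fibre in M(w)'/M; the fibre has [L:M] elements, which accounts for
  -- the index. The two sides are then compared class by class.
  have h2 : (F.index : ℂ) * ((c : ℂ)⁻¹ ^ Fintype.card ι *
      ∑ δ : (L.rescale w).Disc, if w • δ = L.incl w γ ∧ m • δ = L.incl w μ then
        expQZ (-(b • (L.rescale w).q δ)) else 0) =
      ∑ r : (F.rescale w).Grp, ∑ δ, (F.rescale w).proj δ r * ((c : ℂ)⁻¹ ^ Fintype.card ι *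
        if w • δ = L.incl w γ ∧ m • δ = L.incl w μ then
          expQZ (-(b • (L.rescale w).q δ)) else 0) := by
    rw [Finset.sum_comm]
    simp only [← Finset.sum_mul, sum_proj, index_rescale, Finset.mul_sum]
  rw [h1, h2]
  refine Finset.sum_congr rfl fun r _ => ?_
  obtain ⟨y, hy⟩ := (F.rescale w).exists_vec r
  have hd := F.rep_rescaleDown hy
  have hu := F.rep_rescaleUp huw hy
  by_cases hr : ∃ δ, (F.rescale w).Over δ r
  · obtain ⟨δ, hδ⟩ := hr
    rw [sum_disc_proj_mul _ hδ, quad_eq_q _ hδ]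
    have hyδ := (hy.over_iff δ).1 hδ
    simp only [proj, hd.over_iff, hu.over_iff, nsmul_eq_incl_iff hyδ]
    by_cases h1 : L.InCoset γ (w • y) <;> by_cases h2 : L.InCoset μ (m • y) <;> simp [h1, h2]
  -- If wy lies in L', then y lies in L(w)'. So classes outside L(w)'/M contribute to neither side.
  · rw [sum_disc_proj_mul_of_not _ hr, proj, proj, hd.over_iff]
    rw [if_neg (c := L.InCoset γ (w • y)), mul_zero, zero_mul]
    intro h
    have hyd := mem_dual_rescale_iff.2 h.1
    exact hr ⟨_, y, hy, inCoset_mk hyd⟩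

end Frame
end EvenLattice
end

open scoped Classical in
section

/-! ## The extension to the double coset -/

lemma triangular_congr {x y z x' y' z' : ℚ} {c c' : ℝ} {hxz : 0 < x * z} {hc : c ^ 2 = z}
    {hxz' : 0 < x' * z'} {hc' : c' ^ 2 = z'} (hx : x = x') (hy : y = y') (hz : z = z')
    (hcc : c = c') : MpGL.triangular x y z c hxz hc = MpGL.triangular x' y' z' c' hxz' hc' := by
  subst hx hy hz hcc
  rfl

lemma mpAlpha_eq (p l : ℕ) [NeZero p] : mpAlpha p l =
    MpGL.triangular (((p ^ l) ^ 2 : ℕ) : ℚ) ((0 : ℤ) : ℚ) ((1 : ℕ) : ℚ) 1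
      (mul_pos (Nat.cast_pos.2 (NeZero.pos _)) (by norm_num)) (by norm_num) :=
  triangular_congr (by push_cast; ring) (by simp) (by simp) rfl

lemma mpBeta_eq (p l : ℕ) [NeZero p] (b : ℤ) (a : ℕ) : mpBeta p l b a =
    MpGL.triangular ((p ^ (2 * l - a) : ℕ) : ℚ) (b : ℚ) ((p ^ a : ℕ) : ℚ) (Real.sqrt ((p : ℝ) ^ a))
      (mul_pos (Nat.cast_pos.2 (NeZero.pos _)) (Nat.cast_pos.2 (NeZero.pos _)))
      (by rw [Real.sq_sqrt (by positivity)]; push_cast; rfl) :=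
  triangular_congr (by push_cast; rfl) rfl (by push_cast; rfl) rfl

/-- Bézout for the coprime pair p^a, b gives a matrix of SL₂(ℤ) that reduces β to α times a lower
unipotent matrix. -/
lemma exists_eq_mul_mpAlpha_mul {p : ℕ} [NeZero p] {a l : ℕ} (hal : a ≤ 2 * l) {b : ℤ}
    (hb : IsUnit (b : ZMod (p ^ a))) :
    ∃ γ γ' : Mp2Z, mpBeta p l b a = (γ : MpGL) * mpAlpha p l * (γ' : MpGL) := by
  have hcop : IsCoprime ((p ^ a : ℕ) : ℤ) b := (ZMod.coe_int_isUnit_iff_isCoprime b (p ^ a)).1 hb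
  obtain ⟨w, z, hwz⟩ := hcop
  push_cast at hwz
  let M : SL(2, ℤ) := ⟨!![(p : ℤ) ^ a, -b; z, w], by rw [Matrix.det_fin_two_of]; linarith⟩
  let N : SL(2, ℤ) := ⟨!![1, 0; z * (p : ℤ) ^ (2 * l - a), 1], by simp [Matrix.det_fin_two_of]⟩
  obtain ⟨g, -, hg⟩ := exists_closure_mat_eq M
  have hpow : (p : ℚ) ^ a * (p : ℚ) ^ (2 * l - a) = (p : ℚ) ^ (2 * l) := by
    rw [← pow_add, Nat.add_sub_cancel' hal]
  have hwz' : (w : ℚ) * (p : ℚ) ^ a + z * b = 1 := by exact_mod_cast hwz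
  have key : (g : MpGL).mat * (mpBeta p l b a).mat = (mpAlpha p l).mat *
      Matrix.SpecialLinearGroup.toGLPos (N.map (Int.castRingHom ℚ)) := by
    rw [hg]
    apply Subtype.ext
    apply Units.ext
    change ((M.map (Int.castRingHom ℚ) : SL(2, ℚ)) : Matrix (Fin 2) (Fin 2) ℚ) *
        !![(p : ℚ) ^ (2 * l - a), (b : ℚ); 0, (p : ℚ) ^ a] =
      !![(p : ℚ) ^ (2 * l), 0; 0, 1] *
        ((N.map (Int.castRingHom ℚ) : SL(2, ℚ)) : Matrix (Fin 2) (Fin 2) ℚ)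
    rw [Matrix.SpecialLinearGroup.map_apply_coe, Matrix.SpecialLinearGroup.map_apply_coe]
    ext i j
    fin_cases i <;> fin_cases j
    · simp [M, N, Matrix.mul_apply, Fin.sum_univ_two, hpow]
    · simp [M, N, Matrix.mul_apply, Fin.sum_univ_two]; ring
    · simp [M, N, Matrix.mul_apply, Fin.sum_univ_two]
    · simp [M, N, Matrix.mul_apply, Fin.sum_univ_two]; linarith
  -- Taking γ' to be the quotient makes its φ correct automatically; only integrality of its matrix
  -- has to be checked.
  refine ⟨g⁻¹, ⟨(((g⁻¹ : Mp2Z) : MpGL) * mpAlpha p l)⁻¹ * mpBeta p l b a, N, ?_⟩, ?_⟩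
  · rw [MpGL.mul_mat, MpGL.inv_mat, MpGL.mul_mat, Subgroup.coe_inv, MpGL.inv_mat,
      _root_.mul_inv_rev, inv_inv, mul_assoc, key, inv_mul_cancel_left]
  · rw [mul_inv_cancel_left]

namespace EvenLattice

variable {V : Type*} [AddCommGroup V] [Module ℚ V] {L : EvenLattice V}

lemma toMat_alphaOp (m : ℕ) (μ γ : L.Disc) :
    L.toMat (L.alphaOp m) μ γ = if m • γ = μ then 1 else 0 := by
  rw [toMat_apply, alphaOp, basisVec, Finsupp.linearCombination_single, one_smul, basisVec,
    Finsupp.single_apply]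

variable {ι : Type*} [Fintype ι] [DecidableEq ι]

/-- The case w = 1, b = 0 of the entry formula: δ is then γ itself, leaving the condition mγ = μ. -/
lemma toMat_alphaOp_eq (F : L.Frame ι) (m : ℕ) [NeZero m] : L.toMat (L.alphaOp m) =
    (F.index : ℂ)⁻¹ • ((F.scale m).proj * F.tri m (m ^ 2) 1 0 1 * F.projᵀ) := by
  ext μ γ
  rw [toMat_alphaOp, Matrix.smul_apply, F.proj_mul_tri_mul_transpose m (mul_one _), smul_eq_mul,
    inv_mul_cancel_left₀ F.index_ne_zero, Finset.sum_eq_single (L.incl 1 γ)]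
  · simp only [one_smul, true_and, zero_smul, neg_zero, expQZ_zero, ← map_nsmul,
      (incl_injective (L := L) 1).eq_iff]
    simp
  · intro δ _ hδ
    rw [if_neg]
    rintro ⟨h, -⟩
    rw [one_smul] at h
    exact hδ h
  · simp

/-- The intertwining relations carry ρ(γ)⁻¹ and ρ(γ')⁻¹ inside the maps P, where uniqueness of theta
matrices identifies W(γ')W(α)W(γ) with the matrix of the triangular element. The right side no
longer involves γ and γ'. -/
lemma toMat_doubleCosetOp (F : L.Frame ι) {p l : ℕ} [NeZero p] {u w : ℕ} [NeZero u] [NeZero w]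
    (huw : u * w = (p ^ l) ^ 2) {b : ℤ} {c : ℝ} {hxz : (0 : ℚ) < u * w} {hc : c ^ 2 = (w : ℚ)}
    {γ γ' : Mp2Z}
    (h : MpGL.triangular u b w c hxz hc = (γ : MpGL) * mpAlpha p l * (γ' : MpGL)) :
    L.toMat (L.doubleCosetOp p l γ γ') =
      (F.index : ℂ)⁻¹ • ((F.scale (p ^ l)).proj * F.tri (p ^ l) u w b c * F.projᵀ) := by
  obtain ⟨hT, hS⟩ := (isWeilRep_iff _).1 (isWeilRep_weilRep F)
  let R : Mp2Z →* Matrix L.Disc L.Disc ℂ :=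
    L.toMat.toAlgHom.toRingHom.toMonoidHom.comp L.weilRep
  have hR : ∀ g, L.toMat (L.weilRep g) = R g := fun _ => rfl
  have h1 : F.projᵀ * R γ⁻¹ = F.weil γ * F.projᵀ := by
    have hg : R γ * R γ⁻¹ = 1 := by rw [← map_mul, mul_inv_cancel, map_one]
    conv_lhs => rw [← F.weil_mul_transpose R hT hS γ]
    rw [Matrix.mul_assoc, hg, Matrix.mul_one]
  have h2 : R γ'⁻¹ * (F.scale (p ^ l)).proj =
      (F.scale (p ^ l)).proj * (F.scale (p ^ l)).weil γ' := by
    have hg : R γ'⁻¹ * R γ' = 1 := by rw [← map_mul, inv_mul_cancel, map_one]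
    conv_lhs => rw [← (F.scale (p ^ l)).proj_mul_weil R hT hS γ']
    rw [← Matrix.mul_assoc, hg, Matrix.one_mul]
  have h3 : (F.scale (p ^ l)).weil γ' * (F.tri (p ^ l) ((p ^ l) ^ 2) 1 0 1 * F.weil γ) =
      F.tri (p ^ l) u w b c := by
    have hα := F.isTensorThetaMatrix_tri (p ^ l) (mul_one ((p ^ l) ^ 2)) 0 1
      (mul_pos (Nat.cast_pos.2 (NeZero.pos _)) (by norm_num)) (by norm_num)
    rw [← mpAlpha_eq] at hα
    have h4 := ((F.isTensorThetaMatrix_weil γ).mul hα).mul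
      ((F.scale (p ^ l)).isTensorThetaMatrix_weil γ')
    rw [← h] at h4
    exact h4.unique (F.isTensorThetaMatrix_tri (p ^ l) huw b c hxz hc)
  have h5 : L.toMat (L.doubleCosetOp p l γ γ') = R γ'⁻¹ * L.toMat (L.alphaOp (p ^ l)) * R γ⁻¹ := by
    rw [← hR, ← hR, ← map_mul, ← map_mul, mul_assoc]
    rfl
  rw [h5, toMat_alphaOp_eq F, Matrix.mul_smul, Matrix.smul_mul, ← h3]
  congr 1
  calc R γ'⁻¹ * ((F.scale (p ^ l)).proj * F.tri (p ^ l) ((p ^ l) ^ 2) 1 0 1 * F.projᵀ) * R γ⁻¹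
      = (R γ'⁻¹ * (F.scale (p ^ l)).proj) * F.tri (p ^ l) ((p ^ l) ^ 2) 1 0 1 *
          (F.projᵀ * R γ⁻¹) := by simp only [Matrix.mul_assoc]
    _ = _ := by rw [h1, h2]; simp only [Matrix.mul_assoc]

/-- The matrix entries of the operators attached to `β = γ α γ'`. -/
lemma doubleCosetOp_mpBeta_apply {p : ℕ} [NeZero p] {a l : ℕ} (hal : a ≤ 2 * l) {b : ℤ}
    {γ γ' : Mp2Z} (h : mpBeta p l b a = (γ : MpGL) * mpAlpha p l * (γ' : MpGL)) (μ ν : L.Disc) :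
    L.doubleCosetOp p l γ γ' (L.basisVec ν) μ =
      (((p : ℝ) ^ (-((a : ℝ) / 2) * (L.dim : ℝ)) : ℝ) : ℂ) *
        ∑ δ : (L.rescale (p ^ a)).Disc,
          if (p ^ a) • δ = L.incl (p ^ a) ν ∧ (p ^ l) • δ = L.incl (p ^ a) μ then
            expQZ (-(b • (L.rescale (p ^ a)).q δ)) else 0 := by
  obtain ⟨F⟩ := L.nonempty_frame
  have huw : p ^ (2 * l - a) * p ^ a = (p ^ l) ^ 2 := by
    rw [← pow_add, Nat.sub_add_cancel hal, ← pow_mul, mul_comm]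
  have hp : (0 : ℝ) < p := Nat.cast_pos.2 (NeZero.pos p)
  rw [← toMat_apply, toMat_doubleCosetOp F huw ((mpBeta_eq p l b a).symm.trans h),
    Matrix.smul_apply, F.proj_mul_tri_mul_transpose _ huw, smul_eq_mul,
    inv_mul_cancel_left₀ F.index_ne_zero]
  congr 1
  rw [Fintype.card_fin, ← dim_eq_finrank, ← Complex.ofReal_inv, ← Complex.ofReal_pow]
  congr 1
  -- Each of the dim(L) tensor factors contributes φ⁻¹ = p^{-a/2}.
  rw [Real.sqrt_eq_rpow, ← Real.rpow_natCast, ← Real.rpow_natCast, ← Real.rpow_mul hp.le,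
    ← Real.rpow_neg hp.le, ← Real.rpow_mul hp.le]
  congr 1
  ring

lemma extWellDefinedAt_mpBeta (L : EvenLattice V) {p : ℕ} [NeZero p] {a l : ℕ} (hal : a ≤ 2 * l)
    {b : ℤ} (hb : IsUnit (b : ZMod (p ^ a))) : L.ExtWellDefinedAt p l (mpBeta p l b a) := by
  refine ⟨exists_eq_mul_mpAlpha_mul hal hb, fun γ γ' h => ?_⟩
  have hex : ∃ g : Mp2Z × Mp2Z, mpBeta p l b a = (g.1 : MpGL) * mpAlpha p l * (g.2 : MpGL) :=
    ⟨(γ, γ'), h⟩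
  rw [extOp, dif_pos hex]
  apply L.toMat.injective
  ext μ ν
  rw [toMat_apply, toMat_apply, doubleCosetOp_mpBeta_apply hal hex.choose_spec,
    doubleCosetOp_mpBeta_apply hal h]

lemma extOp_mpBeta_apply {p : ℕ} [NeZero p] {a l : ℕ} (hal : a ≤ 2 * l) {b : ℤ}
    (hb : IsUnit (b : ZMod (p ^ a))) (μ ν : L.Disc) :
    L.extOp p l (mpBeta p l b a) (L.basisVec ν) μ =
      (((p : ℝ) ^ (-((a : ℝ) / 2) * (L.dim : ℝ)) : ℝ) : ℂ) *
        ∑ δ : (L.rescale (p ^ a)).Disc,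
          if (p ^ a) • δ = L.incl (p ^ a) ν ∧ (p ^ l) • δ = L.incl (p ^ a) μ then
            expQZ (-(b • (L.rescale (p ^ a)).q δ)) else 0 := by
  obtain ⟨γ, γ', h⟩ := exists_eq_mul_mpAlpha_mul hal hb
  rw [(L.extWellDefinedAt_mpBeta hal hb).2 γ γ' h, doubleCosetOp_mpBeta_apply hal h]

/-- For a ≤ l the condition p^aδ = γ already forces p^lδ = p^{l-a}γ, so only one basis vector
occurs. -/
lemma extOp_mpBeta_basisVec_of_le {p : ℕ} [NeZero p] {a l : ℕ} (hal : a ≤ l) {b : ℤ}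
    (hb : IsUnit (b : ZMod (p ^ a))) (γ : L.Disc) :
    L.extOp p l (mpBeta p l b a) (L.basisVec γ) =
      (((p : ℝ) ^ (-((a : ℝ) / 2) * (L.dim : ℝ)) : ℝ) : ℂ) •
        ∑ δ : (L.rescale (p ^ a)).Disc with (p ^ a) • δ = L.incl (p ^ a) γ,
          expQZ (-(b • (L.rescale (p ^ a)).q δ)) • L.basisVec ((p ^ (l - a)) • γ) := by
  ext μ
  rw [extOp_mpBeta_apply (by omega) hb, Finsupp.smul_apply, Finsupp.finsetSum_apply, smul_eq_mul,
    Finset.sum_filter]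
  congr 1
  refine Finset.sum_congr rfl fun δ _ => ?_
  by_cases h1 : (p ^ a) • δ = L.incl (p ^ a) γ
  · have h2 : (p ^ l) • δ = L.incl (p ^ a) ((p ^ (l - a)) • γ) := by
      rw [map_nsmul, ← h1, smul_smul, ← pow_add, Nat.sub_add_cancel hal]
    rw [if_pos h1, h2, (incl_injective _).eq_iff, basisVec, Finsupp.smul_apply,
      Finsupp.single_apply]
    simp [h1]
  · simp [h1]

/-! ### The case l < a: passage from A(p^a) to A(p^l) -/

lemma dual_rescale_le {w w' : ℕ} [NeZero w] [NeZero w'] (h : w ∣ w') :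
    (L.rescale w).dual ≤ (L.rescale w').dual := by
  obtain ⟨k, rfl⟩ := h
  intro x hx
  rw [mem_dual_rescale_iff] at hx ⊢
  rw [mul_comm, mul_smul]
  exact L.dual.smul_of_tower_mem k hx

/-- The inclusion `A(w) ⊆ A(w')` for `w ∣ w'`. -/
def rescaleIncl (L : EvenLattice V) {w w' : ℕ} [NeZero w] [NeZero w'] (h : w ∣ w') :
    (L.rescale w).Disc →ₗ[ℤ] (L.rescale w').Disc :=
  Submodule.mapQ _ _ (Submodule.inclusion (dual_rescale_le h)) (fun _ hx => hx)

lemma InCoset.rescaleIncl {w w' : ℕ} [NeZero w] [NeZero w'] (h : w ∣ w')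
    {δ : (L.rescale w).Disc} {x : V} (hx : (L.rescale w).InCoset δ x) :
    (L.rescale w').InCoset (L.rescaleIncl h δ) x := by
  obtain ⟨hx, rfl⟩ := hx
  exact ⟨dual_rescale_le h hx, rfl⟩

/-- If p^lδ lies in A, then δ already lies in A(p^l), and there q_{p^a} = p^{a-l} q_{p^l}. -/
lemma sum_rescale_eq {p : ℕ} [NeZero p] {a l : ℕ} (hal : l ≤ a) (b : ℤ) (ν : L.Disc) :
    ∑ δ : (L.rescale (p ^ l)).Disc with (p ^ l) • δ = L.incl (p ^ l) ν,
        expQZ (-((b * (p : ℤ) ^ (a - l)) • (L.rescale (p ^ l)).q δ)) =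
      ∑ δ : (L.rescale (p ^ a)).Disc with (p ^ l) • δ = L.incl (p ^ a) ν,
        expQZ (-(b • (L.rescale (p ^ a)).q δ)) := by
  have hdvd : p ^ l ∣ p ^ a := pow_dvd_pow p hal
  refine Finset.sum_bij (fun δ _ => L.rescaleIncl hdvd δ) ?_ ?_ ?_ ?_
  · intro δ hδ
    obtain ⟨y, hy⟩ := exists_inCoset δ
    rw [Finset.mem_filter, nsmul_eq_incl_iff hy] at hδ
    rw [Finset.mem_filter, nsmul_eq_incl_iff (hy.rescaleIncl hdvd)]
    exact ⟨Finset.mem_univ _, hδ.2⟩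
  · intro δ _ δ' _ h
    obtain ⟨y, hy⟩ := exists_inCoset δ
    obtain ⟨y', hy'⟩ := exists_inCoset δ'
    exact (hy.eq_iff hy').2 (((hy.rescaleIncl hdvd).eq_iff (hy'.rescaleIncl hdvd)).1 h)
  · intro δ hδ
    obtain ⟨y, hy⟩ := exists_inCoset δ
    rw [Finset.mem_filter, nsmul_eq_incl_iff hy] at hδ
    have hy' := inCoset_mk (mem_dual_rescale_iff.2 hδ.2.1)
    refine ⟨_, ?_, ((hy'.rescaleIncl hdvd).eq_iff hy).2 (by simp)⟩
    rw [Finset.mem_filter, nsmul_eq_incl_iff hy']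
    exact ⟨Finset.mem_univ _, hδ.2⟩
  · intro δ _
    obtain ⟨y, hy⟩ := exists_inCoset δ
    rw [hy.q, (hy.rescaleIncl hdvd).q, form_rescale, form_rescale, ← AddCircle.coe_zsmul,
      ← AddCircle.coe_zsmul]
    congr 3
    have hpow : (p : ℚ) ^ a = (p : ℚ) ^ (a - l) * (p : ℚ) ^ l := by
      rw [← pow_add, Nat.sub_add_cancel hal]
    rw [zsmul_eq_mul, zsmul_eq_mul]
    push_cast
    rw [hpow]
    ring

/-- Now p^lδ = μ is the stronger condition: it gives p^aδ = p^{a-l}μ, so the condition on γ becomes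
p^{a-l}μ = γ, free of δ. -/
lemma extOp_mpBeta_basisVec_of_lt {p : ℕ} [NeZero p] {a l : ℕ} (hla : l < a) (hal : a ≤ 2 * l)
    {b : ℤ} (hb : IsUnit (b : ZMod (p ^ a))) (γ : L.Disc) :
    L.extOp p l (mpBeta p l b a) (L.basisVec γ) =
      (((p : ℝ) ^ (-((a : ℝ) / 2) * (L.dim : ℝ)) : ℝ) : ℂ) •
        ∑ μ : L.Disc with (p ^ (a - l)) • μ = γ,
          ∑ δ : (L.rescale (p ^ l)).Disc with (p ^ l) • δ = L.incl (p ^ l) μ,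
            expQZ (-((b * (p : ℤ) ^ (a - l)) • (L.rescale (p ^ l)).q δ)) • L.basisVec μ := by
  ext ν
  rw [extOp_mpBeta_apply hal hb, Finsupp.smul_apply, smul_eq_mul]
  congr 1
  simp only [← Finset.sum_smul, sum_rescale_eq hla.le]
  rw [Finsupp.finsetSum_apply, Finset.sum_filter, Finset.sum_eq_single ν]
  · have h : ∀ δ : (L.rescale (p ^ a)).Disc, (p ^ l) • δ = L.incl (p ^ a) ν →
        ((p ^ a) • δ = L.incl (p ^ a) γ ↔ (p ^ (a - l)) • ν = γ) := by
      intro δ hδ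
      rw [← (incl_injective (L := L) (p ^ a)).eq_iff, map_nsmul, ← hδ, smul_smul, ← pow_add,
        Nat.sub_add_cancel hla.le]
    rw [basisVec, Finsupp.smul_apply, Finsupp.single_eq_same, smul_eq_mul, mul_one,
      Finset.sum_filter]
    split_ifs with hν
    · refine Finset.sum_congr rfl fun δ _ => ?_
      by_cases hδ : (p ^ l) • δ = L.incl (p ^ a) ν
      · rw [if_pos hδ, if_pos ⟨(h δ hδ).2 hν, hδ⟩]
      · rw [if_neg hδ, if_neg fun h => hδ h.2]
    · refine Finset.sum_eq_zero fun δ _ => ?_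
      rw [if_neg]
      rintro ⟨h1, h2⟩
      exact hν ((h δ h2).1 h1)
  · intro μ _ hμ
    simp [basisVec, hμ]
  · simp

end EvenLattice
end

end

open Classical in
theorem propositionp {V : Type*} [AddCommGroup V] [Module ℚ V] (L : EvenLattice V)
    (p : ℕ) [Fact p.Prime] (hp : p ≠ 2) (a l : ℕ) (ha : 0 < a) (hl : 0 < l) (hal : a < 2 * l)
    (b : ℤ) (hb : IsUnit (b : ZMod (p ^ a))) :
    L.IsWeilRep L.weilRep ∧
    L.ExtWellDefinedAt p l (mpBeta p l b a) ∧
    (a ≤ l → ∀ γ : L.Disc,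
      L.extOp p l (mpBeta p l b a) (L.basisVec γ) =
        (((p : ℝ) ^ (-((a : ℝ) / 2) * (L.dim : ℝ)) : ℝ) : ℂ) •
          ∑ δ : (L.rescale (p ^ a)).Disc with (p ^ a) • δ = L.incl (p ^ a) γ,
            expQZ (-(b • (L.rescale (p ^ a)).q δ)) • L.basisVec ((p ^ (l - a)) • γ)) ∧
    (l < a → ∀ γ : L.Disc,
      L.extOp p l (mpBeta p l b a) (L.basisVec γ) =
        (((p : ℝ) ^ (-((a : ℝ) / 2) * (L.dim : ℝ)) : ℝ) : ℂ) •
          ∑ μ : L.Disc with (p ^ (a - l)) • μ = γ,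
            ∑ δ : (L.rescale (p ^ l)).Disc with (p ^ l) • δ = L.incl (p ^ l) μ,
              expQZ (-((b * (p : ℤ) ^ (a - l)) • (L.rescale (p ^ l)).q δ)) • L.basisVec μ) := by
  obtain ⟨F⟩ := L.nonempty_frame
  exact ⟨EvenLattice.isWeilRep_weilRep F, L.extWellDefinedAt_mpBeta hal.le hb,
    fun h γ => EvenLattice.extOp_mpBeta_basisVec_of_le h hb γ,
    fun h γ => EvenLattice.extOp_mpBeta_basisVec_of_lt h hal.le hb γ⟩
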